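/- Let $(X_t)_{t\in\mathbb Z}$ be a process with values in a finite alphabet $\mathcal A$ of $k$ symbols. Assume that it is conditionally stationary: there is a Markov kernel $\kappa$ on $\mathcal A^{\mathbb N}$ such that, for every $t$, $\kappa(x,\cdot)$ is a version of the conditional law of the future $(X_t,X_{t+1},\dots)$ given that the past $(X_{t-1},X_{t-2},\dots)$ equals $x$. Two pasts are equivalent if $\kappa$ assigns the same law to them. The causal states are the equivalence classes that are occupied with positive probability at some time. Assume that, up to null sets, there are only finitely many causal states, and that the process of causal states is irreducible: every causal state can be reached from every other one with positive probability. A word $w$ is possible if it occurs with positive probability. A possible word $w$ is a suffix in the causal state $\sigma$ if almost every history that ends with $w$ belongs to $\sigma$. Let $L$ be such that every causal state contains a suffix of length at most $L$. For a word $w$ let $p_w=\lim_{N\to\infty}\frac1N\sum_{t<N}\Pr(\text{the past at time } t \text{ ends with } w)$ (if the process is stationary, this is the probability of $w$). The true morph of a possible suffix $w$ is $a\mapsto p_{wa}/p_w$. The true morph of a causal state is the law of the next symbol given any past in it. Given data $X_0,\dots,X_{N-1}$, let $n_w$ be the number of occurrences of $w$ in the data that are followed by a further data symbol. The empirical morph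 of $w$ is the distribution of the symbols that follow these occurrences. For a causal state $\sigma$, let $n_\sigma$ and $p_\sigma$ be the sums of $n_w$ and $p_w$ over the suffixes $w$ of length exactly $L$ in $\sigma$. The estimated morph of $\sigma$ is the average of the empirical morphs of these suffixes with weights $n_w$. Put $p^*=\min\{p_w: |w|\le L,\ w \text{ possible}\}$ and $p^*_c=\min_\sigma p_\sigma$, and let $s_c$ be the number of causal states. Let $d(P,Q)=\sum_a|P(a)-Q(a)|$. We say that a suffix or a state is $t$-bad if it has not been seen (its count is $0$) or its estimated morph has distance $d\ge t$ from its true morph. Then the limits $p_w$ exist, $p^*>0$, $p^*_c>0$, and there are a constant $C$ and a strictly increasing function $r$ on $[0,\infty)$ with $r(0)=0$ such that for all $N\ge 0$: 1. for every word $w$ with $|w|\le L$ and every $\varepsilon\ge0$, $\Pr(|n_w/N-p_w|>\varepsilon)\le Ce^{-Nr(\varepsilon)}$, and for every causal state $\sigma$, $\Pr(|n_\sigma/N-p_\sigma|>\varepsilon)\le Ce^{-Nr(\varepsilon)}$; 2. for every $t>0$, the probability $q(t,N)$ that at least one suffix of length at most $L$ in a causal state is $t$-bad satisfies $$q(t,N)\le\inf_{\varepsilon\ge0}\Big(\sum_{l=0}^{L}k^l\Big)\Big(2^{k+1}e^{-N(p^*-\varepsilon)t^2/2}+Ce^{-Nr(\varepsilon)}\Big),$$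 where $\sum_{l=0}^{L}k^l=(k^{L+1}-1)/(k-1)$ for $k\ge2$; 3. for every $t>0$, the probability that at least one causal state is $t$-bad is at most $$\inf_{\varepsilon\ge0}\,s_c\Big(2^{k+1}e^{-N(p^*_c-\varepsilon)t^2/2}+Ce^{-Nr(\varepsilon)}\Big).$$ Moreover there is a constant $B$ such that for every $t>0$ there is $c>0$ such that, for all $N$, the probability that at least one possible word of length at most $L$ (whether or not it is a suffix in a causal state) is $t$-bad is at most $Be^{-cN}$, and so is the probability that at least one causal state is $t$-bad. -/

import Mathlib

open MeasureTheory ProbabilityTheory Filter Topology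

namespace CausalStates

noncomputable section

variable {A Ω : Type*} [MeasurableSpace A] [MeasurableSpace Ω]

/-- The past at time `t`, most recent symbol first: `X (t-1), X (t-2), …`. -/
def past (X : ℤ → Ω → A) (t : ℤ) (ω : Ω) : ℕ → A := fun n => X (t - 1 - n) ω

/-- The future at time `t`: `X t, X (t+1), …`; the next symbol is `X t`. -/
def future (X : ℤ → Ω → A) (t : ℤ) (ω : Ω) : ℕ → A := fun n => X (t + n) ω

/-- `κ x F` is a version of `P(Future_t ∈ F | Past_t = x)`, with one and the same `κ` for all
times `t`. The existence of such a `κ` is conditional stationarity of the process. -/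
def IsPredictiveKernel (P : Measure Ω) (X : ℤ → Ω → A) (κ : Kernel (ℕ → A) (ℕ → A)) : Prop :=
  ∀ t : ℤ, P.map (fun ω => (past X t ω, future X t ω)) = (P.map (past X t)) ⊗ₘ κ

/-- The causal state of a past `x`: all pasts with the same conditional law of the future. -/
def causalState (κ : Kernel (ℕ → A) (ℕ → A)) (x : ℕ → A) : Set (ℕ → A) :=
  {y | ∀ F : Set (ℕ → A), MeasurableSet F → κ y F = κ x F}

/-- The random causal state at time `t`. -/
def stateAt (X : ℤ → Ω → A) (κ : Kernel (ℕ → A) (ℕ → A)) (t : ℤ) (ω : Ω) : Set (ℕ → A) :=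
  causalState κ (past X t ω)

/-- `σ` is a causal state of the process: it is occupied with positive probability at some time.
(Conditional laws are determined up to null sets of pasts only, so null classes are ignored.) -/
def IsCausalState (P : Measure Ω) (X : ℤ → Ω → A) (κ : Kernel (ℕ → A) (ℕ → A))
    (σ : Set (ℕ → A)) : Prop :=
  ∃ t : ℤ, P {ω | stateAt X κ t ω = σ} ≠ 0

/-- Up to null sets there are only finitely many causal states. -/
def FinitelyManyCausalStates (P : Measure Ω) (X : ℤ → Ω → A)
    (κ : Kernel (ℕ → A) (ℕ → A)) : Prop :=
  ∃ S : Set (Set (ℕ → A)), S.Finite ∧ ∀ t : ℤ, ∀ᵐ ω ∂P, stateAt X κ t ω ∈ S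

/-- Every causal state can be reached from every causal state with positive probability. -/
def CausalStatesIrreducible (P : Measure Ω) (X : ℤ → Ω → A)
    (κ : Kernel (ℕ → A) (ℕ → A)) : Prop :=
  ∀ σ τ : Set (ℕ → A), IsCausalState P X κ σ → IsCausalState P X κ τ →
    ∃ (t : ℤ) (n : ℕ), P {ω | stateAt X κ t ω = σ ∧ stateAt X κ (t + n) ω = τ} ≠ 0

/-- The event that the past at time `t` ends with the word `w` (`w` is read forward in time, so
its last letter is `X (t-1)`). -/
def endsWith (X : ℤ → Ω → A) (t : ℤ) (w : List A) : Set Ω :=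
  {ω | ∀ i : Fin w.length, X (t - w.length + (i : ℕ)) ω = w.get i}

/-- The word `w` occurs with positive probability. -/
def IsPossible (P : Measure Ω) (X : ℤ → Ω → A) (w : List A) : Prop :=
  ∃ t : ℤ, P (endsWith X t w) ≠ 0

/-- The suffix `w` belongs to the causal state `σ`: `w` is possible, and almost every history
that ends with `w` lies in `σ`. -/
def IsSuffixIn (P : Measure Ω) (X : ℤ → Ω → A) (κ : Kernel (ℕ → A) (ℕ → A)) (w : List A)
    (σ : Set (ℕ → A)) : Prop :=
  IsPossible P X w ∧ ∀ t : ℤ, ∀ᵐ ω ∂P, ω ∈ endsWith X t w → stateAt X κ t ω = σ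

/-- The probability averaged over the times `0, …, N-1` that the past ends with `w`. -/
def avgWordProb (P : Measure Ω) (X : ℤ → Ω → A) (w : List A) (N : ℕ) : ℝ :=
  (∑ t ∈ Finset.range N, P.real (endsWith X t w)) / N

/-- The (long-run) probability of the word `w`. For a stationary process the averages do not
depend on `N ≥ 1` and this is the probability that the past ends with `w`. -/
def wordProb (P : Measure Ω) (X : ℤ → Ω → A) (w : List A) : ℝ :=
  limUnder atTop (avgWordProb P X w)

/-- The true morph of the suffix `w`: the probability that `a` follows `w`. -/
def wordMorph (P : Measure Ω) (X : ℤ → Ω → A) (w : List A) (a : A) : ℝ :=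
  wordProb P X (w ++ [a]) / wordProb P X w

/-- The probability of the least probable possible word of length at most `L`. -/
def pStar (P : Measure Ω) (X : ℤ → Ω → A) (L : ℕ) : ℝ :=
  sInf (wordProb P X '' {w | w.length ≤ L ∧ IsPossible P X w})

open Classical in
/-- The number of occurrences of `w` in the data `X 0, …, X (N-1)` that are followed by
a further data symbol. -/
def count (X : ℤ → Ω → A) (N : ℕ) (w : List A) (ω : Ω) : ℕ :=
  ((Finset.range N).filter (fun t : ℕ => w.length ≤ t ∧ ω ∈ endsWith X t w)).card

open Classical in
/-- The number of occurrences of `w` in the data `X 0, …, X (N-1)` that are followed by `a`. -/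
def countNext (X : ℤ → Ω → A) (N : ℕ) (w : List A) (a : A) (ω : Ω) : ℕ :=
  ((Finset.range N).filter
    (fun t : ℕ => w.length ≤ t ∧ ω ∈ endsWith X t w ∧ X t ω = a)).card

/-- The maximum-likelihood estimate of the morph of `w` (meaningful if `w` has been seen). -/
def empMorph (X : ℤ → Ω → A) (N : ℕ) (w : List A) (ω : Ω) (a : A) : ℝ :=
  (countNext X N w a ω : ℝ) / count X N w ω

/-- The variational distance, without the factor `1/2`. -/
def varDist [Fintype A] (p q : A → ℝ) : ℝ := ∑ a, |p a - q a|

/-- The estimated morph of `w` fails to be within `t` of the true one, or `w` was not seen. -/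
def WordFails [Fintype A] (P : Measure Ω) (X : ℤ → Ω → A) (N : ℕ) (t : ℝ) (w : List A)
    (ω : Ω) : Prop :=
  count X N w ω = 0 ∨ t ≤ varDist (empMorph X N w ω) (wordMorph P X w)

open Classical in
/-- The true morph of a causal state `σ`: the law of the next symbol given any past in `σ`. -/
def stateMorph (κ : Kernel (ℕ → A) (ℕ → A)) (σ : Set (ℕ → A)) (a : A) : ℝ :=
  if h : σ.Nonempty then (κ h.some).real {f | f 0 = a} else 0

open Classical in
/-- The words of length `L` (as functions on `Fin L`) that are suffixes in the state `σ`. -/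
def stateWords [Fintype A] (P : Measure Ω) (X : ℤ → Ω → A) (κ : Kernel (ℕ → A) (ℕ → A)) (L : ℕ)
    (σ : Set (ℕ → A)) : Finset (Fin L → A) :=
  Finset.univ.filter (fun u => IsSuffixIn P X κ (List.ofFn u) σ)

/-- The probability of seeing the state `σ` through a history of length `L`. -/
def stateProb [Fintype A] (P : Measure Ω) (X : ℤ → Ω → A) (κ : Kernel (ℕ → A) (ℕ → A)) (L : ℕ)
    (σ : Set (ℕ → A)) : ℝ :=
  ∑ u ∈ stateWords P X κ L σ, wordProb P X (List.ofFn u)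

/-- The probability of the causal state that is seen least often. -/
def pStarState [Fintype A] (P : Measure Ω) (X : ℤ → Ω → A) (κ : Kernel (ℕ → A) (ℕ → A))
    (L : ℕ) : ℝ :=
  sInf (stateProb P X κ L '' {σ | IsCausalState P X κ σ})

/-- How often the state `σ` has been seen in the data through histories of length `L`. -/
def stateCount [Fintype A] (P : Measure Ω) (X : ℤ → Ω → A) (κ : Kernel (ℕ → A) (ℕ → A)) (L N : ℕ)
    (σ : Set (ℕ → A)) (ω : Ω) : ℕ :=
  ∑ u ∈ stateWords P X κ L σ, count X N (List.ofFn u) ω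

/-- The estimated morph of the state `σ`: the average of the estimated morphs of the histories
of length `L` in `σ`, weighted by their counts. -/
def stateEmpMorph [Fintype A] (P : Measure Ω) (X : ℤ → Ω → A) (κ : Kernel (ℕ → A) (ℕ → A))
    (L N : ℕ) (σ : Set (ℕ → A)) (ω : Ω) (a : A) : ℝ :=
  (∑ u ∈ stateWords P X κ L σ, (count X N (List.ofFn u) ω : ℝ) * empMorph X N (List.ofFn u) ω a) /
    stateCount P X κ L N σ ω

/-- The estimated morph of `σ` fails to be within `t` of the true one, or `σ` was not seen. -/
def StateFails [Fintype A] (P : Measure Ω) (X : ℤ → Ω → A) (κ : Kernel (ℕ → A) (ℕ → A)) (L N : ℕ)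
    (t : ℝ) (σ : Set (ℕ → A)) (ω : Ω) : Prop :=
  stateCount P X κ L N σ ω = 0 ∨ t ≤ varDist (stateEmpMorph P X κ L N σ ω) (stateMorph κ σ)

end

end CausalStates

/-! The next causal state is a function of the present one and the next symbol. One kernel serves
all times, so by uniqueness of disintegration the conditional law of the future at a past determines
the law at each extension of positive probability (`ae_isConsistentAt`, `kernel_cons_eq`). Hence the
causal states form a finite irreducible Markov chain with one transition matrix `q`
(`exists_transition`). Neither stationarity nor aperiodicity is needed.

Counts concentrate by a martingale argument. Replacing a bounded function of the past by its
conditional expectation one step earlier changes the sum over `N` times by a bounded term plus a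
martingale with bounded increments, which has Gaussian tails by Hoeffding's lemma
(`negligible_pastSum_sub_nextMean`). The conditional expectation of the indicator of `w ++ [a]`
times a function of the state is the indicator of `w` times another function of the state. Peeling
off all letters leaves a sum of some function `h` of the state, and the Poisson equation `h = c + u
- q u` makes this sum `N * c` up to the same kind of error (`exists_rate_indicator_stateFun`). So
the word probabilities exist, and `r ε` can be a multiple of `ε ^ 2`. A minimum principle gives `0 <
c` for possible words (`poisson_pos`).

At visits to a suffix or to a state, the next symbol has a fixed conditional law. For every subset
of the alphabet, an exponential supermartingale that moves only at visits controls the empirical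
morph although the number of visits is random (`measureReal_varDist_ge_le`); that this number is at
least `N * (p - ε)` follows from the concentration of counts. A possible word that is not a suffix
has no such fixed law, but its empirical morph is a ratio of two concentrating counts
(`exists_bound_possible`). -/

namespace CausalStates

noncomputable section

set_option linter.unusedSectionVars false

/-! ### Pasts, futures and the law of the next symbol -/

section Basic

variable {A Ω : Type*} [MeasurableSpace A] [MeasurableSpace Ω]

/-- The past `x` extended by the new symbol `a`. -/
def cons (a : A) (x : ℕ → A) : ℕ → A
  | 0 => a
  | n + 1 => x n

/-- The sequence `x` without its first symbol. -/
def tail (x : ℕ → A) : ℕ → A := fun n => x (n + 1)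

@[simp] lemma cons_zero (a : A) (x : ℕ → A) : cons a x 0 = a := rfl

@[simp] lemma cons_succ (a : A) (x : ℕ → A) (n : ℕ) : cons a x (n + 1) = x n := rfl

@[simp] lemma tail_cons (a : A) (x : ℕ → A) : tail (cons a x) = x := rfl

lemma measurable_tail : Measurable (tail : (ℕ → A) → ℕ → A) :=
  measurable_pi_iff.2 fun n => measurable_pi_apply (n + 1)

lemma measurable_cons : Measurable (fun p : A × (ℕ → A) => cons p.1 p.2) :=
  measurable_pi_iff.2 fun n => by
    cases n with
    | zero => exact measurable_fst
    | succ n => exact (measurable_pi_apply n).comp measurable_snd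

lemma past_succ (X : ℤ → Ω → A) (t : ℤ) (ω : Ω) :
    past X (t + 1) ω = cons (X t ω) (past X t ω) := by
  funext n
  cases n with
  | zero => simp [past]
  | succ n =>
    simp only [past, cons_succ]
    congr 1
    push_cast
    ring

lemma future_apply_zero (X : ℤ → Ω → A) (t : ℤ) (ω : Ω) : future X t ω 0 = X t ω := by
  simp [future]

lemma tail_future (X : ℤ → Ω → A) (t : ℤ) (ω : Ω) : tail (future X t ω) = future X (t + 1) ω := by
  funext n
  simp only [tail, future]
  congr 1
  push_cast
  ring

lemma measurable_past {X : ℤ → Ω → A} (hX : ∀ t, Measurable (X t)) (t : ℤ) :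
    Measurable (past X t) :=
  measurable_pi_iff.2 fun _ => hX _

lemma measurable_future {X : ℤ → Ω → A} (hX : ∀ t, Measurable (X t)) (t : ℤ) :
    Measurable (future X t) :=
  measurable_pi_iff.2 fun _ => hX _

/-- The conditional law of the next symbol. -/
def nextLaw (κ : Kernel (ℕ → A) (ℕ → A)) : Kernel (ℕ → A) A := κ.map (fun f => f 0)

instance (κ : Kernel (ℕ → A) (ℕ → A)) [IsMarkovKernel κ] : IsMarkovKernel (nextLaw κ) :=
  Kernel.IsMarkovKernel.map κ (measurable_pi_apply 0)

lemma nextLaw_apply (κ : Kernel (ℕ → A) (ℕ → A)) (x : ℕ → A) :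
    nextLaw κ x = (κ x).map (fun f => f 0) :=
  Kernel.map_apply κ (measurable_pi_apply 0) x

/-- All laws of pasts together: a property holds almost everywhere iff, at every time, it holds
for almost every past. -/
def pastLaw (P : Measure Ω) (X : ℤ → Ω → A) : Measure (ℕ → A) :=
  Measure.sum fun t : ℤ => P.map (past X t)

lemma ae_pastLaw_iff {P : Measure Ω} {X : ℤ → Ω → A} {p : (ℕ → A) → Prop} :
    (∀ᵐ x ∂pastLaw P X, p x) ↔ ∀ t, ∀ᵐ x ∂P.map (past X t), p x :=
  Measure.ae_sum_iff

lemma ae_past {P : Measure Ω} {X : ℤ → Ω → A} (hX : ∀ t, Measurable (X t)) {p : (ℕ → A) → Prop}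
    (h : ∀ᵐ x ∂pastLaw P X, p x) (t : ℤ) : ∀ᵐ ω ∂P, p (past X t ω) :=
  ae_of_ae_map (measurable_past hX t).aemeasurable (ae_pastLaw_iff.1 h t)

lemma ae_pastLaw_of_forall {P : Measure Ω} {X : ℤ → Ω → A} (hX : ∀ t, Measurable (X t))
    {p : (ℕ → A) → Prop} (hp : MeasurableSet {x | p x}) (h : ∀ t, ∀ᵐ ω ∂P, p (past X t ω)) :
    ∀ᵐ x ∂pastLaw P X, p x :=
  ae_pastLaw_iff.2 fun t => (ae_map_iff (measurable_past hX t).aemeasurable hp).2 (h t)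

variable {P : Measure Ω} [IsProbabilityMeasure P] {X : ℤ → Ω → A} {κ : Kernel (ℕ → A) (ℕ → A)}
  [IsMarkovKernel κ]

lemma lintegral_past_future (hX : ∀ t, Measurable (X t)) (hκ : IsPredictiveKernel P X κ) (t : ℤ)
    {H : (ℕ → A) × (ℕ → A) → ENNReal} (hH : Measurable H) :
    ∫⁻ ω, H (past X t ω, future X t ω) ∂P = ∫⁻ ω, ∫⁻ f, H (past X t ω, f) ∂κ (past X t ω) ∂P := by
  have := Measure.isProbabilityMeasure_map (μ := P) (measurable_past hX t).aemeasurable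
  rw [← lintegral_map hH ((measurable_past hX t).prodMk (measurable_future hX t)), hκ t,
    Measure.lintegral_compProd hH,
    lintegral_map (Measurable.lintegral_kernel_prod_right' hH) (measurable_past hX t)]

lemma lintegral_past_next (hX : ∀ t, Measurable (X t)) (hκ : IsPredictiveKernel P X κ) (t : ℤ)
    {H : (ℕ → A) × A → ENNReal} (hH : Measurable H) :
    ∫⁻ ω, H (past X t ω, X t ω) ∂P =
      ∫⁻ ω, ∫⁻ a, H (past X t ω, a) ∂nextLaw κ (past X t ω) ∂P := by
  have h := lintegral_past_future hX hκ t (H := fun p => H (p.1, p.2 0))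
    (hH.comp (measurable_fst.prodMk ((measurable_pi_apply 0).comp measurable_snd)))
  simp only [future_apply_zero] at h
  rw [h]
  congr with ω
  rw [nextLaw_apply, lintegral_map (f := fun a => H (past X t ω, a)) (hH.comp measurable_prodMk_left)
    (measurable_pi_apply 0)]

/-- Transfers statements about the kernel to the symbol that the process actually emits. -/
lemma ae_next {p : (ℕ → A) → A → Prop} (hX : ∀ t, Measurable (X t))
    (hκ : IsPredictiveKernel P X κ) (hp : MeasurableSet {q : (ℕ → A) × A | p q.1 q.2})
    (h : ∀ᵐ x ∂pastLaw P X, ∀ᵐ a ∂nextLaw κ x, p x a) (t : ℤ) :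
    ∀ᵐ ω ∂P, p (past X t ω) (X t ω) := by
  have hm : Measurable ({q : (ℕ → A) × A | p q.1 q.2}ᶜ.indicator (1 : (ℕ → A) × A → ENNReal)) :=
    measurable_one.indicator hp.compl
  have h0 : ∫⁻ ω, {q : (ℕ → A) × A | p q.1 q.2}ᶜ.indicator (1 : (ℕ → A) × A → ENNReal)
      (past X t ω, X t ω) ∂P = 0 := by
    rw [lintegral_past_next hX hκ t hm]
    refine lintegral_eq_zero_of_ae_eq_zero ?_
    filter_upwards [ae_past hX h t] with ω hω
    refine lintegral_eq_zero_of_ae_eq_zero ?_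
    filter_upwards [hω] with a ha
    simp [ha]
  replace h0 := (lintegral_eq_zero_iff (hm.comp ((measurable_past hX t).prodMk (hX t)))).1 h0
  filter_upwards [h0] with ω hω
  by_contra hc
  simp [hc] at hω

/-- The past at time `t + 1` is the past at time `t` extended by a symbol drawn from `nextLaw κ`, so
a null set of pasts is avoided by almost every extension too. -/
lemma ae_ae_cons {p : (ℕ → A) → Prop} (hX : ∀ t, Measurable (X t))
    (hκ : IsPredictiveKernel P X κ) (hp : MeasurableSet {x | p x})
    (h : ∀ᵐ x ∂pastLaw P X, p x) : ∀ᵐ x ∂pastLaw P X, ∀ᵐ a ∂nextLaw κ x, p (cons a x) := by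
  have hm : Measurable (fun q : (ℕ → A) × A => {x | p x}ᶜ.indicator (1 : (ℕ → A) → ENNReal)
      (cons q.2 q.1)) :=
    (measurable_one.indicator hp.compl).comp (measurable_cons.comp measurable_swap)
  have hm' := Measurable.lintegral_kernel_prod_right' (κ := nextLaw κ) hm
  have key : ∀ᵐ x ∂pastLaw P X,
      ∫⁻ a, {x | p x}ᶜ.indicator (1 : (ℕ → A) → ENNReal) (cons a x) ∂nextLaw κ x = 0 := by
    refine ae_pastLaw_of_forall hX (hm' (measurableSet_singleton 0)) fun t => ?_
    have h0 := lintegral_past_next hX hκ t hm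
    simp only [← past_succ] at h0
    have h1 : ∫⁻ ω, {x | p x}ᶜ.indicator (1 : (ℕ → A) → ENNReal) (past X (t + 1) ω) ∂P = 0 := by
      refine lintegral_eq_zero_of_ae_eq_zero ?_
      filter_upwards [ae_past hX h (t + 1)] with ω hω
      simp [hω]
    exact (lintegral_eq_zero_iff (hm'.comp (measurable_past hX t))).1 (h0.symm.trans h1)
  filter_upwards [key] with x hx
  replace hx := (lintegral_eq_zero_iff (hm.comp measurable_prodMk_left)).1 hx
  filter_upwards [hx] with a ha
  by_contra hc
  simp [hc] at ha

/-! ### Consistency of the conditional laws and measurability of causal states -/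

section Finite

variable [Fintype A] [MeasurableSingletonClass A]

lemma ae_iff_forall_of_fintype {μ : Measure A} {p : A → Prop} :
    (∀ᵐ a ∂μ, p a) ↔ ∀ a, μ {a} ≠ 0 → p a :=
  ae_iff_of_countable

lemma integral_fintype' (μ : Measure A) [IsFiniteMeasure μ] (g : A → ℝ) :
    ∫ a, g a ∂μ = ∑ a, μ.real {a} * g a := by
  rw [integral_fintype (Integrable.of_finite)]
  simp

/-- At the past `x`, the conditional law of the future is obtained by drawing the next symbol and
then the rest of the future given the extended past. -/
def IsConsistentAt (κ : Kernel (ℕ → A) (ℕ → A)) [IsMarkovKernel κ] (x : ℕ → A) : Prop :=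
  (κ x).map (fun f => (f 0, tail f)) =
      (nextLaw κ ⊗ₖ κ.comap (fun p : (ℕ → A) × A => cons p.2 p.1)
        (measurable_cons.comp measurable_swap)) x

/-- Both sides disintegrate the joint law of past, next symbol and later future at time `t`: one
uses `κ` at time `t`, the other draws one symbol and then uses `κ` at time `t + 1`. Disintegrations
are almost everywhere unique. -/
lemma ae_isConsistentAt (hX : ∀ t, Measurable (X t)) (hκ : IsPredictiveKernel P X κ) :
    ∀ᵐ x ∂pastLaw P X, IsConsistentAt κ x := by
  refine ae_pastLaw_iff.2 fun t => ?_
  have := Measure.isProbabilityMeasure_map (μ := P) (measurable_past hX t).aemeasurable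
  have hg : Measurable (fun f : ℕ → A => (f 0, tail f)) :=
    (measurable_pi_apply 0).prodMk measurable_tail
  have := Kernel.IsMarkovKernel.map κ hg
  set η := nextLaw κ ⊗ₖ κ.comap (fun p : (ℕ → A) × A => cons p.2 p.1)
        (measurable_cons.comp measurable_swap) with hη
  have h : κ.map (fun f => (f 0, tail f)) =ᵐ[P.map (past X t)] η := by
    refine Kernel.ae_eq_of_compProd_eq (Measure.ext_of_lintegral _ fun H hH => ?_)
    rw [Measure.lintegral_compProd hH, Measure.lintegral_compProd hH,
      lintegral_map (Measurable.lintegral_kernel_prod_right' hH) (measurable_past hX t),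
      lintegral_map (Measurable.lintegral_kernel_prod_right' hH) (measurable_past hX t)]
    have h1 := lintegral_past_future hX hκ t (H := fun p => H (p.1, (p.2 0, tail p.2)))
      (hH.comp (measurable_fst.prodMk (hg.comp measurable_snd)))
    -- The past at time `t + 1` contains both the past at time `t` and the symbol `X t`, so the same
    -- integral can be computed from there.
    have h2 := lintegral_past_future hX hκ (t + 1) (H := fun p => H (tail p.1, (p.1 0, p.2)))
      (hH.comp ((measurable_tail.comp measurable_fst).prodMk
        (((measurable_pi_apply 0).comp measurable_fst).prodMk measurable_snd)))
    have hH3 : Measurable fun p : ((ℕ → A) × A) × (ℕ → A) => H (p.1.1, (p.1.2, p.2)) :=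
      hH.comp ((measurable_fst.comp measurable_fst).prodMk
        ((measurable_snd.comp measurable_fst).prodMk measurable_snd))
    have h3 := lintegral_past_next hX hκ t (H := fun q => ∫⁻ f, H (q.1, (q.2, f))
      ∂κ.comap (fun p : (ℕ → A) × A => cons p.2 p.1) (measurable_cons.comp measurable_swap) q)
      (Measurable.lintegral_kernel_prod_right' hH3)
    simp only [future_apply_zero, tail_future, past_succ, tail_cons, cons_zero,
      Kernel.comap_apply] at h1 h2 h3
    calc _ = ∫⁻ ω, ∫⁻ f, H (past X t ω, (f 0, tail f)) ∂κ (past X t ω) ∂P := by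
          congr with ω
          rw [Kernel.map_apply _ hg, lintegral_map (f := fun q => H (past X t ω, q))
            (hH.comp measurable_prodMk_left) hg]
      _ = _ := by rw [← h1, h2, h3]
      _ = _ := by
          congr with ω
          rw [hη, Kernel.lintegral_compProd _ _ _ (f := fun q => H (past X t ω, q))
            (hH.comp measurable_prodMk_left)]
          rfl
  filter_upwards [h] with x hx
  rw [IsConsistentAt, ← hx, Kernel.map_apply _ hg]

lemma nextLaw_mul_kernel_cons {x : ℕ → A} (hx : IsConsistentAt κ x) (a : A) {F : Set (ℕ → A)}
    (hF : MeasurableSet F) :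
    nextLaw κ x {a} * κ (cons a x) F = (κ x).map (fun f => (f 0, tail f)) ({a} ×ˢ F) := by
  rw [show _ = _ from hx, Kernel.compProd_apply_prod (measurableSet_singleton a) hF,
    lintegral_singleton, mul_comm]
  rfl

/-- The equivalence class of a past is determined by the class of the previous past and the
last symbol. -/
lemma kernel_cons_eq {x y : ℕ → A} (hx : IsConsistentAt κ x) (hy : IsConsistentAt κ y)
    (hxy : κ x = κ y) (a : A) (ha : nextLaw κ x {a} ≠ 0) : κ (cons a x) = κ (cons a y) := by
  refine Measure.ext fun F hF => ?_
  have h1 := nextLaw_mul_kernel_cons hx a hF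
  have h2 := nextLaw_mul_kernel_cons hy a hF
  have h3 : nextLaw κ x = nextLaw κ y := by rw [nextLaw_apply, nextLaw_apply, hxy]
  rw [← hxy, ← h1, ← h3] at h2
  exact ((ENNReal.mul_right_inj ha (measure_ne_top _ _)).1 h2).symm

lemma mem_causalState_iff {x y : ℕ → A} : y ∈ causalState κ x ↔ κ y = κ x :=
  ⟨fun h => Measure.ext h, fun h F _ => by rw [h]⟩

/-- The product σ-algebra is generated by a countable algebra, and agreement of two probability laws
on it suffices. The class is thus a countable intersection of measurable conditions. -/
lemma measurableSet_causalState (x : ℕ → A) : MeasurableSet (causalState κ x) := by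
  set 𝒞 := generateSetAlgebra (MeasurableSpace.countableGeneratingSet (ℕ → A)) with h𝒞
  have hc : 𝒞.Countable :=
    countable_generateSetAlgebra (MeasurableSpace.countable_countableGeneratingSet)
  have hgen : (MeasurableSpace.pi : MeasurableSpace (ℕ → A)) = MeasurableSpace.generateFrom 𝒞 := by
    rw [h𝒞, generateFrom_generateSetAlgebra_eq,
      MeasurableSpace.generateFrom_countableGeneratingSet]
  have hpi : IsPiSystem 𝒞 := fun s hs t ht _ =>
    (isSetAlgebra_generateSetAlgebra).inter_mem hs ht
  have : causalState κ x = ⋂ F ∈ 𝒞, {y | κ y F = κ x F} := by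
    ext y
    simp only [Set.mem_iInter, Set.mem_ofPred_eq]
    refine ⟨fun h F hF => h F (hgen ▸ MeasurableSpace.measurableSet_generateFrom hF), fun h => ?_⟩
    exact mem_causalState_iff.2 (ext_of_generate_finite 𝒞 hgen hpi h (by simp))
  rw [this]
  refine MeasurableSet.biInter hc fun F hF => ?_
  exact κ.measurable_coe (hgen ▸ MeasurableSpace.measurableSet_generateFrom hF)
    (measurableSet_singleton _)

end Finite

end Basic

/-! ### Exponential supermartingales and martingale approximation -/

section Concentration

variable {A Ω : Type*} [MeasurableSpace A] [MeasurableSpace Ω]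
variable {P : Measure Ω} [IsProbabilityMeasure P] {X : ℤ → Ω → A} {κ : Kernel (ℕ → A) (ℕ → A)}
  [IsMarkovKernel κ]

section Supermartingale

/-- The product of the factors `g t` along the last `n` steps of a past. -/
def stepProd (g : ℕ → (ℕ → A) → A → ENNReal) : ℕ → (ℕ → A) → ENNReal
  | 0, _ => 1
  | n + 1, x => stepProd g n (tail x) * g n (tail x) (x 0)

lemma measurable_stepProd {g : ℕ → (ℕ → A) → A → ENNReal}
    (hg : ∀ t, Measurable (fun q : (ℕ → A) × A => g t q.1 q.2)) (n : ℕ) :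
    Measurable (stepProd g n) := by
  induction n with
  | zero => exact measurable_const
  | succ n ih =>
    exact (ih.comp measurable_tail).mul
      ((hg n).comp (measurable_tail.prodMk (measurable_pi_apply 0)))

lemma stepProd_past (g : ℕ → (ℕ → A) → A → ENNReal) (n : ℕ) (ω : Ω) :
    stepProd g n (past X n ω) = ∏ t ∈ Finset.range n, g t (past X t ω) (X t ω) := by
  induction n with
  | zero => simp [stepProd]
  | succ n ih =>
    rw [Finset.prod_range_succ, ← ih]
    push_cast
    rw [past_succ]
    simp [stepProd]

/-- Condition on the past at time `n`: the first `n` factors are a function `stepProd` of that past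
and come out of the inner integral, and the last factor integrates to at most `1`. -/
lemma lintegral_prod_le_one (hX : ∀ t, Measurable (X t)) (hκ : IsPredictiveKernel P X κ)
    {g : ℕ → (ℕ → A) → A → ENNReal}
    (hg : ∀ t, Measurable (fun q : (ℕ → A) × A => g t q.1 q.2))
    (h1 : ∀ t, ∀ᵐ x ∂pastLaw P X, ∫⁻ a, g t x a ∂nextLaw κ x ≤ 1) (N : ℕ) :
    ∫⁻ ω, ∏ t ∈ Finset.range N, g t (past X t ω) (X t ω) ∂P ≤ 1 := by
  induction N with
  | zero => simp
  | succ n ih =>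
    refine le_trans (le_of_eq ?_) (le_trans (lintegral_mono_ae (f := fun ω => ∫⁻ a,
      stepProd g n (past X n ω) * g n (past X n ω) a ∂nextLaw κ (past X n ω)) ?_) ih)
    · have := lintegral_past_next hX hκ n (H := fun q => stepProd g n q.1 * g n q.1 q.2)
        (((measurable_stepProd hg n).comp measurable_fst).mul (hg n))
      rw [← this]
      simp only [Finset.prod_range_succ, stepProd_past]
    · filter_upwards [ae_past hX (h1 n) n] with ω hω
      rw [lintegral_const_mul (f := fun a => g n (past X n ω) a) _
        ((hg n).comp measurable_prodMk_left), ← stepProd_past]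
      exact mul_le_of_le_one_right' hω

/-- Chernoff's bound for sums of step functions with conditional exponential moment at most `1`. -/
lemma measureReal_le_exp_neg (hX : ∀ t, Measurable (X t)) (hκ : IsPredictiveKernel P X κ)
    {d : ℕ → (ℕ → A) → A → ℝ} (hd : ∀ t, Measurable (fun q : (ℕ → A) × A => d t q.1 q.2))
    (h1 : ∀ t, ∀ᵐ x ∂pastLaw P X, ∫⁻ a, ENNReal.ofReal (Real.exp (d t x a)) ∂nextLaw κ x ≤ 1)
    (N : ℕ) (s : ℝ) :
    P.real {ω | s ≤ ∑ t ∈ Finset.range N, d t (past X t ω) (X t ω)} ≤ Real.exp (-s) := by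
  have hm : Measurable fun ω => ∏ t ∈ Finset.range N,
      ENNReal.ofReal (Real.exp (d t (past X t ω) (X t ω))) :=
    Finset.measurable_prod _ fun t _ => ENNReal.measurable_ofReal.comp (Real.measurable_exp.comp
      ((hd t).comp ((measurable_past hX t).prodMk (hX t))))
  have h := (mul_meas_ge_le_lintegral (μ := P) hm (ENNReal.ofReal (Real.exp s))).trans
    (lintegral_prod_le_one hX hκ (g := fun t x a => ENNReal.ofReal (Real.exp (d t x a)))
    (fun t => ENNReal.measurable_ofReal.comp (Real.measurable_exp.comp (hd t))) h1 N)
  have hset : {ω | ENNReal.ofReal (Real.exp s) ≤ ∏ t ∈ Finset.range N,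
      ENNReal.ofReal (Real.exp (d t (past X t ω) (X t ω)))} =
      {ω | s ≤ ∑ t ∈ Finset.range N, d t (past X t ω) (X t ω)} := by
    ext ω
    rw [Set.mem_ofPred_eq, Set.mem_ofPred_eq,
      ← ENNReal.ofReal_prod_of_nonneg fun _ _ => (Real.exp_pos _).le, ← Real.exp_sum,
      ENNReal.ofReal_le_ofReal_iff (Real.exp_pos _).le, Real.exp_le_exp]
  rw [hset] at h
  have h' := ENNReal.toReal_mono ENNReal.one_ne_top h
  rw [ENNReal.toReal_mul, ENNReal.toReal_ofReal (Real.exp_pos _).le, ENNReal.toReal_one] at h'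
  rw [Real.exp_neg, ← one_div, le_div_iff₀ (Real.exp_pos _), mul_comm]
  exact h'

/-- The conditional expectation of `φ` at the next time, as a function of the past. -/
def nextMean (κ : Kernel (ℕ → A) (ℕ → A)) (φ : (ℕ → A) → ℝ) (x : ℕ → A) : ℝ :=
  ∫ a, φ (cons a x) ∂nextLaw κ x

lemma measurable_nextMean {φ : (ℕ → A) → ℝ} (hφ : Measurable φ) : Measurable (nextMean κ φ) := by
  have : StronglyMeasurable (fun q : (ℕ → A) × A => φ (cons q.2 q.1)) :=
    (hφ.comp (measurable_cons.comp measurable_swap)).stronglyMeasurable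
  exact (this.integral_kernel_prod_right' (κ := nextLaw κ)).measurable

lemma abs_nextMean_le {φ : (ℕ → A) → ℝ} {K : ℝ} (hK : ∀ x, |φ x| ≤ K) (x : ℕ → A) :
    |nextMean κ φ x| ≤ K := by
  have := norm_integral_le_of_norm_le_const (μ := nextLaw κ x) (f := fun a => φ (cons a x))
    (C := K) (Eventually.of_forall fun a => hK _)
  simpa [nextMean] using this

/-- Hoeffding's lemma in terms of the lower Lebesgue integral. -/
lemma lintegral_exp_sub_integral_le {E : Type*} [MeasurableSpace E] (μ : Measure E)
    [IsProbabilityMeasure μ] {Y : E → ℝ} (hY : Measurable Y) {a b : ℝ} (hab : a ≤ b)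
    (h : ∀ y, Y y ∈ Set.Icc a b) (s : ℝ) :
    ∫⁻ y, ENNReal.ofReal (Real.exp (s * (Y y - ∫ z, Y z ∂μ) - ((b - a) / 2) ^ 2 * s ^ 2 / 2)) ∂μ
      ≤ 1 := by
  have hsub := hasSubgaussianMGF_of_mem_Icc (μ := μ) hY.aemeasurable (Eventually.of_forall h)
  have h1 := hsub.mgf_le s
  have hc : (((‖b - a‖₊ / 2) ^ 2 : NNReal) : ℝ) = ((b - a) / 2) ^ 2 := by
    push_cast
    rw [Real.norm_of_nonneg (by linarith)]
  rw [hc, mgf] at h1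
  rw [← ofReal_integral_eq_lintegral_ofReal]
  · rw [← ENNReal.ofReal_one]
    refine ENNReal.ofReal_le_ofReal ?_
    simp only [Real.exp_sub]
    rw [integral_div, div_le_one (Real.exp_pos _)]
    exact h1
  · simp only [Real.exp_sub]
    exact (hsub.integrable_exp_mul s).div_const _
  · exact Eventually.of_forall fun a => (Real.exp_pos _).le

lemma lintegral_exp_sub_nextMean_le {φ : (ℕ → A) → ℝ} (hφ : Measurable φ) {K : ℝ} (hK0 : 0 ≤ K)
    (hK : ∀ x, |φ x| ≤ K) (s : ℝ) (x : ℕ → A) :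
    ∫⁻ a, ENNReal.ofReal (Real.exp (s * (φ (cons a x) - nextMean κ φ x) - K ^ 2 * s ^ 2 / 2))
      ∂nextLaw κ x ≤ 1 := by
  have h := lintegral_exp_sub_integral_le (nextLaw κ x) (Y := fun a => φ (cons a x))
    (hφ.comp (measurable_cons.comp measurable_prodMk_right)) (a := -K) (b := K) (by linarith)
    (fun a => abs_le.1 (hK _)) s
  rwa [show (K - -K) / 2 = K by ring] at h

lemma measureReal_sum_sub_nextMean_le (hX : ∀ t, Measurable (X t)) (hκ : IsPredictiveKernel P X κ)
    {φ : (ℕ → A) → ℝ} (hφ : Measurable φ) {K : ℝ} (hK0 : 0 < K)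
    (hK : ∀ x, |φ x| ≤ K) (N : ℕ) {ε : ℝ} (hε : 0 ≤ ε) :
    P.real {ω | N * ε ≤ ∑ t ∈ Finset.range N,
      (φ (past X (t + 1) ω) - nextMean κ φ (past X t ω))} ≤
      Real.exp (-((2 * K ^ 2)⁻¹ * N * ε ^ 2)) := by
  have hd : Measurable (fun q : (ℕ → A) × A => ε / K ^ 2 * (φ (cons q.2 q.1) -
      nextMean κ φ q.1) - K ^ 2 * (ε / K ^ 2) ^ 2 / 2) :=
    ((((hφ.comp (measurable_cons.comp measurable_swap))).sub
      ((measurable_nextMean hφ).comp measurable_fst)).const_mul _).sub_const _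
  -- The parameter `ε / K ^ 2` minimises the exponent `-s * N * ε + N * K ^ 2 * s ^ 2 / 2` over `s`.
  have h := measureReal_le_exp_neg hX hκ (d := fun _ x a => ε / K ^ 2 * (φ (cons a x) -
      nextMean κ φ x) - K ^ 2 * (ε / K ^ 2) ^ 2 / 2) (fun _ => hd)
    (fun _ => Eventually.of_forall fun x => lintegral_exp_sub_nextMean_le hφ hK0.le hK _ x)
    N ((2 * K ^ 2)⁻¹ * N * ε ^ 2)
  refine le_trans (measureReal_mono fun ω hω => ?_) h
  simp only [Set.mem_ofPred_eq] at hω ⊢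
  simp only [past_succ] at hω
  rw [Finset.sum_sub_distrib, ← Finset.mul_sum, Finset.sum_const, Finset.card_range, nsmul_eq_mul]
  have h2 := mul_le_mul_of_nonneg_left hω (show 0 ≤ ε / K ^ 2 by positivity)
  refine le_trans (le_of_eq ?_) (sub_le_sub_right h2 _)
  field_simp
  ring

end Supermartingale

/-- Sequences of random variables with bounded expectations and Gaussian tails on the scale
of `N`. -/
structure Negligible (P : Measure Ω) (Z : ℕ → Ω → ℝ) : Prop where
  integrable : ∀ N, Integrable (Z N) P
  mean : ∃ b, ∀ N, |∫ ω, Z N ω ∂P| ≤ b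
  tail : ∃ C c : ℝ, 0 ≤ C ∧ 0 < c ∧ ∀ (N : ℕ) (ε : ℝ), 0 ≤ ε →
    P.real {ω | N * ε < |Z N ω|} ≤ C * Real.exp (-(c * N * ε ^ 2))

/-! ### Calculus of negligible sequences -/

namespace Negligible

variable {Z Z' : ℕ → Ω → ℝ}

lemma congr_ae (h : Negligible P Z) (hZ : ∀ N, Z N =ᵐ[P] Z' N) : Negligible P Z' where
  integrable N := (h.integrable N).congr (hZ N)
  mean := by
    obtain ⟨b, hb⟩ := h.mean
    exact ⟨b, fun N => by rw [← integral_congr_ae (hZ N)]; exact hb N⟩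
  tail := by
    obtain ⟨C, c, hC, hc, h⟩ := h.tail
    refine ⟨C, c, hC, hc, fun N ε hε => le_trans (le_of_eq ?_) (h N ε hε)⟩
    refine measureReal_congr ?_
    filter_upwards [hZ N] with ω hω
    change (_ < |Z' N ω|) = (_ < |Z N ω|)
    rw [hω]

lemma add (h : Negligible P Z) (h' : Negligible P Z') :
    Negligible P (fun N ω => Z N ω + Z' N ω) where
  integrable N := (h.integrable N).add (h'.integrable N)
  mean := by
    obtain ⟨b, hb⟩ := h.mean
    obtain ⟨b', hb'⟩ := h'.mean
    refine ⟨b + b', fun N => ?_⟩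
    rw [integral_add (h.integrable N) (h'.integrable N)]
    exact (abs_add_le _ _).trans (add_le_add (hb N) (hb' N))
  tail := by
    obtain ⟨C, c, hC, hc, h⟩ := h.tail
    obtain ⟨C', c', hC', hc', h'⟩ := h'.tail
    -- One of the two summands must exceed its half of the threshold; halving `ε` costs the factor
    -- `4`.
    refine ⟨C + C', min c c' / 4, by positivity, by positivity, fun N ε hε => ?_⟩
    have hsub : {ω | N * ε < |Z N ω + Z' N ω|} ⊆
        {ω | N * (ε / 2) < |Z N ω|} ∪ {ω | N * (ε / 2) < |Z' N ω|} := by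
      intro ω hω
      simp only [Set.mem_union, Set.mem_ofPred_eq] at hω ⊢
      by_contra! hcon
      have := abs_add_le (Z N ω) (Z' N ω)
      linarith [hcon.1, hcon.2]
    have hN : (0 : ℝ) ≤ N * (ε / 2) ^ 2 := by positivity
    calc _ ≤ _ := (measureReal_mono hsub).trans (measureReal_union_le _ _)
      _ ≤ C * Real.exp (-(c * N * (ε / 2) ^ 2)) + C' * Real.exp (-(c' * N * (ε / 2) ^ 2)) :=
        add_le_add (h N _ (by positivity)) (h' N _ (by positivity))
      _ ≤ C * Real.exp (-(min c c' / 4 * N * ε ^ 2)) +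
          C' * Real.exp (-(min c c' / 4 * N * ε ^ 2)) := by
        have h1 := mul_le_mul_of_nonneg_right (min_le_left c c') hN
        have h2 := mul_le_mul_of_nonneg_right (min_le_right c c') hN
        refine add_le_add (mul_le_mul_of_nonneg_left (Real.exp_le_exp.2 ?_) hC)
          (mul_le_mul_of_nonneg_left (Real.exp_le_exp.2 ?_) hC') <;> linarith
      _ = _ := by ring

lemma neg (h : Negligible P Z) : Negligible P (fun N ω => -Z N ω) where
  integrable N := (h.integrable N).neg
  mean := by simpa [integral_neg] using h.mean
  tail := by simpa using h.tail

lemma sub (h : Negligible P Z) (h' : Negligible P Z') :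
    Negligible P (fun N ω => Z N ω - Z' N ω) := by
  simpa only [sub_eq_add_neg] using h.add h'.neg

lemma of_bounded {b : ℝ} (hm : ∀ N, Measurable (Z N)) (hb : ∀ N ω, |Z N ω| ≤ b) :
    Negligible P Z where
  integrable N := Integrable.of_bound (hm N).aestronglyMeasurable b
    (Eventually.of_forall fun ω => hb N ω)
  mean := ⟨b, fun N => by
    simpa using norm_integral_le_of_norm_le_const (μ := P) (f := Z N) (C := b)
      (Eventually.of_forall fun ω => hb N ω)⟩
  tail := by
    refine ⟨Real.exp (b ^ 2), 1, (Real.exp_pos _).le, one_pos, fun N ε hε => ?_⟩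
    rw [← Real.exp_add]
    -- Here, for `N ≥ 1`, `N * ε ^ 2 ≤ (N * ε) ^ 2 ≤ b ^ 2`, and the constant `exp (b ^ 2)` lifts
    -- the bound to at least `1`. In the other case the event is empty.
    by_cases h : N * ε < b
    · refine measureReal_le_one.trans (Real.one_le_exp ?_)
      rcases Nat.eq_zero_or_pos N with rfl | hN
      · simpa using sq_nonneg b
      · have hN' : (1 : ℝ) ≤ N := by exact_mod_cast hN
        have h1 : (N * ε) ^ 2 ≤ b ^ 2 := pow_le_pow_left₀ (by positivity) h.le 2
        have h2 : N * ε ^ 2 ≤ N * (N * ε ^ 2) := le_mul_of_one_le_left (by positivity) hN'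
        nlinarith
    · have : {ω | N * ε < |Z N ω|} = ∅ := by
        ext ω
        simp only [Set.mem_ofPred_eq, Set.mem_empty_iff_false, iff_false, not_lt]
        exact (hb N ω).trans (not_lt.1 h)
      rw [this]
      simpa using (Real.exp_pos _).le

lemma sum {ι : Type*} (s : Finset ι) {Z : ι → ℕ → Ω → ℝ} (h : ∀ i ∈ s, Negligible P (Z i)) :
    Negligible P (fun N ω => ∑ i ∈ s, Z i N ω) := by
  classical
  induction s using Finset.induction_on with
  | empty => exact of_bounded (b := 0) (fun N => by simp) (fun N ω => by simp)
  | insert i s hi ih =>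
    simp only [Finset.sum_insert hi]
    exact (h i (by simp)).add (ih fun j hj => h j (by simp [hj]))

/-- The averaged expectations of a negligible sequence tend to zero. -/
lemma tendsto_mean (h : Negligible P Z) :
    Tendsto (fun N : ℕ => (∫ ω, Z N ω ∂P) / N) atTop (𝓝 0) := by
  obtain ⟨b, hb⟩ := h.mean
  refine squeeze_zero_norm (a := fun N : ℕ => b / N) (fun N => ?_)
    (tendsto_const_div_atTop_nhds_zero_nat b)
  rw [norm_div, Real.norm_eq_abs, Real.norm_natCast]
  exact div_le_div_of_nonneg_right (hb N) (Nat.cast_nonneg N)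

/-- Common constants for finitely many negligible sequences. -/
lemma uniform_tail {ι : Type*} (s : Finset ι) {Z : ι → ℕ → Ω → ℝ}
    (h : ∀ i ∈ s, Negligible P (Z i)) :
    ∃ C c : ℝ, 0 ≤ C ∧ 0 < c ∧ ∀ i ∈ s, ∀ (N : ℕ) (ε : ℝ), 0 ≤ ε →
      P.real {ω | N * ε < |Z i N ω|} ≤ C * Real.exp (-(c * N * ε ^ 2)) := by
  classical
  induction s using Finset.induction_on with
  | empty => exact ⟨0, 1, le_rfl, one_pos, by simp⟩
  | insert i s hi ih =>
    obtain ⟨C, c, hC, hc, h1⟩ := ih fun j hj => h j (by simp [hj])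
    obtain ⟨C', c', hC', hc', h2⟩ := (h i (by simp)).tail
    refine ⟨max C C', min c c', by positivity, by positivity, fun j hj N ε hε => ?_⟩
    rcases Finset.mem_insert.1 hj with rfl | hj
    · refine (h2 N ε hε).trans ?_
      gcongr
      exacts [le_max_right _ _, min_le_right _ _]
    · refine (h1 j hj N ε hε).trans ?_
      gcongr
      exacts [le_max_left _ _, min_le_left _ _]

end Negligible

/-- The sum of `φ` over the pasts at the times `0, …, N - 1`. -/
def pastSum (X : ℤ → Ω → A) (φ : (ℕ → A) → ℝ) (N : ℕ) (ω : Ω) : ℝ :=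
  ∑ t ∈ Finset.range N, φ (past X t ω)

lemma measurable_pastSum (hX : ∀ t, Measurable (X t)) {φ : (ℕ → A) → ℝ} (hφ : Measurable φ)
    (N : ℕ) : Measurable (pastSum X φ N) :=
  Finset.measurable_sum _ fun t _ => hφ.comp (measurable_past hX t)

lemma pastSum_congr_ae (hX : ∀ t, Measurable (X t)) {φ ψ : (ℕ → A) → ℝ}
    (h : ∀ᵐ x ∂pastLaw P X, φ x = ψ x) (N : ℕ) : pastSum X φ N =ᵐ[P] pastSum X ψ N := by
  have : ∀ᵐ ω ∂P, ∀ t : ℤ, φ (past X t ω) = ψ (past X t ω) := ae_all_iff.2 fun t => ae_past hX h t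
  filter_upwards [this] with ω hω
  exact Finset.sum_congr rfl fun t _ => hω t

lemma integral_past_succ (hX : ∀ t, Measurable (X t)) (hκ : IsPredictiveKernel P X κ)
    {φ : (ℕ → A) → ℝ} (hφ : Measurable φ) {K : ℝ} (hK : ∀ x, |φ x| ≤ K) (t : ℤ) :
    ∫ ω, φ (past X (t + 1) ω) ∂P = ∫ ω, nextMean κ φ (past X t ω) ∂P := by
  have := Measure.isProbabilityMeasure_map (μ := P) (measurable_past hX t).aemeasurable
  have hcm : Measurable (fun q : (ℕ → A) × (ℕ → A) => φ (cons (q.2 0) q.1)) := by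
    have h : Measurable (fun q : (ℕ → A) × (ℕ → A) => (q.2 0, q.1)) := by fun_prop
    exact hφ.comp (measurable_cons.comp h)
  have h1 : ∫ ω, φ (past X (t + 1) ω) ∂P =
      ∫ q, φ (cons (q.2 0) q.1) ∂P.map (fun ω => (past X t ω, future X t ω)) := by
    rw [integral_map ((measurable_past hX t).prodMk (measurable_future hX t)).aemeasurable
      hcm.aestronglyMeasurable]
    simp only [future_apply_zero, past_succ]
  rw [h1, hκ t, Measure.integral_compProd (Integrable.of_bound hcm.aestronglyMeasurable K
    (Eventually.of_forall fun q => hK _)), integral_map (measurable_past hX t).aemeasurable]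
  · congr with ω
    rw [nextMean, nextLaw_apply, integral_map (measurable_pi_apply 0).aemeasurable]
    exact (hφ.comp (measurable_cons.comp measurable_prodMk_right)).aestronglyMeasurable
  · exact (hcm.stronglyMeasurable.integral_kernel_prod_right' (κ := κ)).aestronglyMeasurable

/-- Replacing a function of the past by its conditional expectation one step earlier changes
the sum by a bounded amount and a martingale. -/
lemma negligible_pastSum_sub_nextMean (hX : ∀ t, Measurable (X t))
    (hκ : IsPredictiveKernel P X κ) {φ : (ℕ → A) → ℝ} (hφ : Measurable φ) {K : ℝ}
    (hK : ∀ x, |φ x| ≤ K) :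
    Negligible P (fun N ω => pastSum X φ N ω - pastSum X (nextMean κ φ) N ω) := by
  -- The Chernoff parameter divides by the square of the bound, which must therefore be positive.
  have hK' : ∀ x, |φ x| ≤ max K 1 := fun x => (hK x).trans (le_max_left _ _)
  set K₁ := max K 1
  have hK₁ : 0 < K₁ := lt_max_of_lt_right one_pos
  have hi1 : ∀ t : ℤ, Integrable (fun ω => φ (past X t ω)) P := fun t =>
    Integrable.of_bound (hφ.comp (measurable_past hX t)).aestronglyMeasurable K
      (Eventually.of_forall fun ω => hK _)
  have hi2 : ∀ t : ℤ, Integrable (fun ω => nextMean κ φ (past X t ω)) P := fun t =>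
    Integrable.of_bound ((measurable_nextMean hφ).comp (measurable_past hX t)).aestronglyMeasurable
      K (Eventually.of_forall fun ω => abs_nextMean_le hK _)
  have hmart : Negligible P (fun N ω => ∑ t ∈ Finset.range N,
      (φ (past X (t + 1) ω) - nextMean κ φ (past X t ω))) := by
    refine ⟨fun N => integrable_finsetSum _ fun t _ => (hi1 _).sub (hi2 _), ⟨0, fun N => ?_⟩,
      ⟨2, (2 * K₁ ^ 2)⁻¹, zero_le_two, by positivity, fun N ε hε => ?_⟩⟩
    · rw [integral_finsetSum _ fun t _ => by exact (hi1 _).sub (hi2 _)]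
      refine le_of_eq (abs_eq_zero.2 (Finset.sum_eq_zero fun t _ => ?_))
      rw [integral_sub (hi1 _) (hi2 _), integral_past_succ hX hκ hφ hK, sub_self]
    · have h1 := measureReal_sum_sub_nextMean_le hX hκ hφ hK₁ hK' N hε
      have h2 := measureReal_sum_sub_nextMean_le hX hκ (φ := fun x => -φ x) hφ.neg hK₁
        (fun x => by rw [abs_neg]; exact hK' x) N hε
      have hneg : nextMean κ (fun x => -φ x) = fun x => -nextMean κ φ x := by
        funext x
        exact integral_neg _
      simp only [hneg] at h2
      rw [two_mul]
      refine le_trans (measureReal_mono fun ω hω => ?_)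
        ((measureReal_union_le _ _).trans (add_le_add h1 h2))
      simp only [Set.mem_union, Set.mem_ofPred_eq] at hω ⊢
      rcases lt_abs.1 hω with h | h
      · exact Or.inl h.le
      · right
        refine h.le.trans (le_of_eq ?_)
        rw [← Finset.sum_neg_distrib]
        exact Finset.sum_congr rfl fun t _ => by ring
  have hbd : Negligible P (fun N ω => φ (past X 0 ω) - φ (past X N ω)) :=
    Negligible.of_bounded (b := K + K)
      (fun N => (hφ.comp (measurable_past hX _)).sub (hφ.comp (measurable_past hX _)))
      fun N ω => (abs_sub _ _).trans (add_le_add (hK _) (hK _))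
  -- The martingale pairs the past at `t + 1` with the past at `t`; telescoping shifts the time back
  -- and leaves the two end terms of `hbd`.
  refine (hmart.add hbd).congr_ae fun N => Eventually.of_forall fun ω => ?_
  have h := Finset.sum_range_sub (fun t : ℕ => φ (past X t ω)) N
  simp only [pastSum, Finset.sum_sub_distrib] at h ⊢
  push_cast at h
  linarith

end Concentration

/-! ### The Poisson equation of a finite irreducible chain -/

section Poisson

variable {S : Type*} [Fintype S] {q : S → S → ℝ}

/-- A superharmonic function of an irreducible finite Markov chain is constant. -/
lemma eq_const_of_superharmonic [Nonempty S] (h0 : ∀ i j, 0 ≤ q i j) (h1 : ∀ i, ∑ j, q i j = 1)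
    (hirr : ∀ R : Set S, R.Nonempty → (∀ i ∈ R, ∀ j, 0 < q i j → j ∈ R) → R = Set.univ)
    {u : S → ℝ} (hu : ∀ i, ∑ j, q i j * u j ≤ u i) : ∃ m, ∀ i, u i = m := by
  obtain ⟨i₀, hi₀⟩ := Finite.exists_min u
  refine ⟨u i₀, fun i => ?_⟩
  -- Minimum principle: a minimiser that could move to a larger value would have a strictly larger
  -- mean after one step, so the set of minimisers is closed.
  suffices h : {i | u i = u i₀} = Set.univ from (Set.ext_iff.1 h i).2 trivial
  refine hirr _ ⟨i₀, rfl⟩ fun i hi j hj => ?_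
  by_contra hne
  have hlt : u i₀ < u j := lt_of_le_of_ne (hi₀ j) (Ne.symm hne)
  have : ∑ k, q i k * u i₀ < ∑ k, q i k * u k :=
    Finset.sum_lt_sum (fun k _ => mul_le_mul_of_nonneg_left (hi₀ k) (h0 i k))
      ⟨j, Finset.mem_univ j, mul_lt_mul_of_pos_left hlt hj⟩
  rw [← Finset.sum_mul, h1, one_mul] at this
  have hi' : u i = u i₀ := hi
  linarith [hu i]

/-- Normalising `c = u i₀` turns the equation into a square linear system, so uniqueness implies
existence. No stationary distribution or convergence of powers of `q` enters. -/
lemma exists_poisson [Nonempty S] (h0 : ∀ i j, 0 ≤ q i j) (h1 : ∀ i, ∑ j, q i j = 1)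
    (hirr : ∀ R : Set S, R.Nonempty → (∀ i ∈ R, ∀ j, 0 < q i j → j ∈ R) → R = Set.univ)
    (h : S → ℝ) : ∃ (c : ℝ) (u : S → ℝ), ∀ i, h i = c + u i - ∑ j, q i j * u j := by
  obtain ⟨i₀⟩ := ‹Nonempty S›
  let T : (S → ℝ) →ₗ[ℝ] (S → ℝ) :=
    { toFun := fun u i => u i₀ + u i - ∑ j, q i j * u j
      map_add' := fun u v => by
        funext i
        simp only [Pi.add_apply, mul_add, Finset.sum_add_distrib]
        ring
      map_smul' := fun a u => by
        funext i
        simp only [Pi.smul_apply, smul_eq_mul, RingHom.id_apply, mul_sub, mul_add, Finset.mul_sum]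
        congr 1
        exact Finset.sum_congr rfl fun j _ => by ring }
  have hinj : Function.Injective T := by
    refine (injective_iff_map_eq_zero T).2 fun u hu => ?_
    have hu' : ∀ i, u i₀ + u i - ∑ j, q i j * u j = 0 := fun i => congrFun hu i
    have key : ∀ v : S → ℝ, (∀ i, ∑ j, q i j * v j ≤ v i) → ∃ m, ∀ i, v i = m :=
      fun v => eq_const_of_superharmonic h0 h1 hirr
    have hconst : ∃ m, ∀ i, u i = m := by
      -- On the kernel, `u - q u` is the constant `-u i₀`, so either `u` or `-u` is superharmonic,
      -- according to the sign.
      rcases le_total (u i₀) 0 with hle | hle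
      · exact key u fun i => by linarith [hu' i]
      · obtain ⟨m, hm⟩ := key (fun i => -u i) fun i => by
          simp only [mul_neg, Finset.sum_neg_distrib]
          linarith [hu' i]
        exact ⟨-m, fun i => by rw [← hm i, neg_neg]⟩
    obtain ⟨m, hm⟩ := hconst
    have hm0 := hu' i₀
    simp only [hm, ← Finset.sum_mul, h1] at hm0
    funext i
    rw [hm i]
    simp only [Pi.zero_apply]
    linarith
  obtain ⟨u, hu⟩ := LinearMap.surjective_of_injective hinj h
  exact ⟨u i₀, u, fun i => (congrFun hu i).symm⟩

/-- If `c ≤ 0`, then `u - q u = h - c ≥ 0`, so `u` is constant, and `h = c ≤ 0` forces `h = 0`. -/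
lemma poisson_pos [Nonempty S] (h0 : ∀ i j, 0 ≤ q i j) (h1 : ∀ i, ∑ j, q i j = 1)
    (hirr : ∀ R : Set S, R.Nonempty → (∀ i ∈ R, ∀ j, 0 < q i j → j ∈ R) → R = Set.univ)
    {h u : S → ℝ} {c : ℝ} (hc : ∀ i, h i = c + u i - ∑ j, q i j * u j) (hh : ∀ i, 0 ≤ h i)
    (hne : ∃ i, h i ≠ 0) : 0 < c := by
  by_contra! hc0
  obtain ⟨m, hm⟩ := eq_const_of_superharmonic h0 h1 hirr (u := u) fun i => by
    linarith [hc i, hh i]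
  obtain ⟨i, hi⟩ := hne
  have h2 := hc i
  simp only [hm, ← Finset.sum_mul, h1] at h2
  exact hi (le_antisymm (by linarith) (hh i))

end Poisson

/-! ### Causal states as a finite set, and functions of the state -/

section States

variable {A Ω : Type*} [Fintype A] [MeasurableSpace A] [MeasurableSingletonClass A]
  [MeasurableSpace Ω]
variable {P : Measure Ω} [IsProbabilityMeasure P] {X : ℤ → Ω → A} {κ : Kernel (ℕ → A) (ℕ → A)}
  [IsMarkovKernel κ]

lemma finite_causalStates (hfin : FinitelyManyCausalStates P X κ) :
    {σ | IsCausalState P X κ σ}.Finite := by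
  obtain ⟨S, hS, hS'⟩ := hfin
  refine hS.subset fun σ ⟨t, ht⟩ => ?_
  by_contra hσ
  refine ht (measure_mono_null (fun ω hω => ?_) (ae_iff.1 (hS' t)))
  have : stateAt X κ t ω = σ := hω
  simpa [this] using hσ

lemma ae_isCausalState_stateAt (hfin : FinitelyManyCausalStates P X κ) (t : ℤ) :
    ∀ᵐ ω ∂P, IsCausalState P X κ (stateAt X κ t ω) := by
  obtain ⟨S, hS, hS'⟩ := hfin
  have h : ∀ᵐ ω ∂P, ∀ σ ∈ S, stateAt X κ t ω = σ → IsCausalState P X κ σ := by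
    refine (ae_ball_iff hS.countable).2 fun σ _ => ?_
    by_cases hσ : IsCausalState P X κ σ
    · exact Eventually.of_forall fun _ _ => hσ
    · have h0 : P {ω | stateAt X κ t ω = σ} = 0 := by
        by_contra h
        exact hσ ⟨t, h⟩
      have : ∀ᵐ ω ∂P, ¬ stateAt X κ t ω = σ := by
        rw [ae_iff]
        simpa using h0
      filter_upwards [this] with ω hω h' using absurd h' hω
  filter_upwards [h, hS' t] with ω h1 h2 using h1 _ h2 rfl

lemma mem_causalState_self (x : ℕ → A) : x ∈ causalState κ x := fun _ _ => rfl

lemma causalState_congr {x y : ℕ → A} (h : κ x = κ y) : causalState κ x = causalState κ y := by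
  ext z
  rw [mem_causalState_iff, mem_causalState_iff, h]

lemma kernel_eq_of_causalState_eq {x y : ℕ → A} (h : causalState κ x = causalState κ y) :
    κ x = κ y :=
  mem_causalState_iff.1 (h ▸ mem_causalState_self x)

lemma IsCausalState.exists_eq {σ : Set (ℕ → A)} (hσ : IsCausalState P X κ σ) :
    ∃ x, σ = causalState κ x := by
  obtain ⟨t, ht⟩ := hσ
  obtain ⟨ω, hω⟩ := nonempty_of_measure_ne_zero ht
  exact ⟨past X t ω, hω.symm⟩

lemma IsCausalState.mem_iff {σ : Set (ℕ → A)} (hσ : IsCausalState P X κ σ) {x : ℕ → A} :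
    x ∈ σ ↔ causalState κ x = σ := by
  obtain ⟨y, rfl⟩ := hσ.exists_eq
  exact ⟨fun h => causalState_congr (mem_causalState_iff.1 h), fun h => h ▸ mem_causalState_self x⟩

lemma IsCausalState.measurableSet {σ : Set (ℕ → A)} (hσ : IsCausalState P X κ σ) :
    MeasurableSet σ := by
  obtain ⟨y, rfl⟩ := hσ.exists_eq
  exact measurableSet_causalState y

lemma ae_isCausalState (hX : ∀ t, Measurable (X t)) (hfin : FinitelyManyCausalStates P X κ) :
    MeasurableSet {x | IsCausalState P X κ (causalState κ x)} ∧
      ∀ᵐ x ∂pastLaw P X, IsCausalState P X κ (causalState κ x) := by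
  have hm : MeasurableSet {x | IsCausalState P X κ (causalState κ x)} := by
    have : {x | IsCausalState P X κ (causalState κ x)} = ⋃ σ ∈ {σ | IsCausalState P X κ σ}, σ := by
      ext x
      simp only [Set.mem_ofPred_eq, Set.mem_iUnion, exists_prop]
      exact ⟨fun h => ⟨_, h, mem_causalState_self x⟩, fun ⟨σ, hσ, hx⟩ => (hσ.mem_iff.1 hx) ▸ hσ⟩
    rw [this]
    exact MeasurableSet.biUnion (finite_causalStates hfin).countable fun σ hσ =>
      IsCausalState.measurableSet hσ
  exact ⟨hm, ae_pastLaw_of_forall hX hm fun t => ae_isCausalState_stateAt hfin t⟩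

/-- A past at which the conditional laws fit together and null causal states are avoided. -/
structure IsRegular (P : Measure Ω) (X : ℤ → Ω → A) (κ : Kernel (ℕ → A) (ℕ → A))
    [IsMarkovKernel κ] (x : ℕ → A) : Prop where
  consistent : IsConsistentAt κ x
  isCausalState : IsCausalState P X κ (causalState κ x)
  isCausalState_cons : ∀ a, nextLaw κ x {a} ≠ 0 → IsCausalState P X κ (causalState κ (cons a x))

lemma ae_isRegular (hX : ∀ t, Measurable (X t)) (hκ : IsPredictiveKernel P X κ)
    (hfin : FinitelyManyCausalStates P X κ) : ∀ᵐ x ∂pastLaw P X, IsRegular P X κ x := by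
  obtain ⟨hm, hs⟩ := ae_isCausalState (κ := κ) hX hfin
  filter_upwards [ae_isConsistentAt hX hκ, hs, ae_ae_cons hX hκ hm hs] with x h1 h2 h3
  exact ⟨h1, h2, ae_iff_forall_of_fintype.1 h3⟩

lemma IsCausalState.exists_of_ae (hX : ∀ t, Measurable (X t)) {σ : Set (ℕ → A)}
    (hσ : IsCausalState P X κ σ) {p : (ℕ → A) → Prop} (hp : ∀ᵐ x ∂pastLaw P X, p x) :
    ∃ x, causalState κ x = σ ∧ p x := by
  obtain ⟨t, ht⟩ := hσ
  by_contra! h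
  refine ht (measure_mono_null (fun ω hω => ?_) (ae_iff.1 (ae_past hX hp t)))
  exact h _ hω

/-- The causal states as a type. -/
abbrev State (P : Measure Ω) (X : ℤ → Ω → A) (κ : Kernel (ℕ → A) (ℕ → A)) : Type _ :=
  {σ : Set (ℕ → A) // IsCausalState P X κ σ}

variable [Fintype (State P X κ)]

/-- A function of the causal state as a function of the past. -/
def stateFun (h : State P X κ → ℝ) (x : ℕ → A) : ℝ :=
  ∑ σ : State P X κ, σ.1.indicator (fun _ => h σ) x

lemma stateFun_eq (h : State P X κ → ℝ) {x : ℕ → A} {σ : State P X κ} (hx : causalState κ x = σ) :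
    stateFun h x = h σ := by
  classical
  rw [stateFun, Finset.sum_eq_single σ]
  · rw [Set.indicator_of_mem (σ.2.mem_iff.2 hx)]
  · intro τ _ hτ
    rw [Set.indicator_of_notMem]
    intro hmem
    exact hτ (Subtype.ext ((τ.2.mem_iff.1 hmem).symm.trans hx))
  · simp

lemma stateFun_congr (h : State P X κ → ℝ) {x y : ℕ → A} (hxy : κ x = κ y) :
    stateFun h x = stateFun h y := by
  refine Finset.sum_congr rfl fun σ _ => ?_
  have : x ∈ σ.1 ↔ y ∈ σ.1 := by
    rw [σ.2.mem_iff, σ.2.mem_iff, causalState_congr hxy]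
  by_cases hy : y ∈ σ.1
  · rw [Set.indicator_of_mem hy, Set.indicator_of_mem (this.2 hy)]
  · rw [Set.indicator_of_notMem hy, Set.indicator_of_notMem (fun h' => hy (this.1 h'))]

lemma measurable_stateFun (h : State P X κ → ℝ) : Measurable (stateFun h) :=
  Finset.measurable_sum _ fun σ _ => measurable_const.indicator σ.2.measurableSet

lemma abs_stateFun_le (h : State P X κ → ℝ) (x : ℕ → A) : |stateFun h x| ≤ ∑ σ, |h σ| := by
  refine (Finset.abs_sum_le_sum_abs _ _).trans (Finset.sum_le_sum fun σ _ => ?_)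
  by_cases hx : x ∈ σ.1
  · rw [Set.indicator_of_mem hx]
  · rw [Set.indicator_of_notMem hx, abs_zero]
    exact abs_nonneg _

lemma stateFun_nonneg {h : State P X κ → ℝ} (h0 : ∀ σ, 0 ≤ h σ) (x : ℕ → A) : 0 ≤ stateFun h x :=
  Finset.sum_nonneg fun σ _ => Set.indicator_nonneg (fun _ _ => h0 σ) x

lemma nextMean_eq_sum (φ : (ℕ → A) → ℝ) (x : ℕ → A) :
    nextMean κ φ x = ∑ a, (nextLaw κ x).real {a} * φ (cons a x) :=
  integral_fintype' _ _

lemma nextLaw_congr {x y : ℕ → A} (h : κ x = κ y) : nextLaw κ x = nextLaw κ y := by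
  rw [nextLaw_apply, nextLaw_apply, h]

/-- Letters of probability zero contribute nothing; for all others the state of the extended past
depends only on the present state. The weight is needed because extensions of probability zero are
uncontrolled. -/
lemma IsRegular.nextLaw_mul_stateFun_congr {x y : ℕ → A} (hx : IsRegular P X κ x)
    (hy : IsRegular P X κ y) (h : State P X κ → ℝ) (hxy : κ x = κ y) (a : A) :
    (nextLaw κ x).real {a} * stateFun h (cons a x) =
      (nextLaw κ y).real {a} * stateFun h (cons a y) := by
  rw [← nextLaw_congr hxy]
  by_cases ha : nextLaw κ x {a} = 0
  · simp [Measure.real, ha]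
  · rw [stateFun_congr h (kernel_cons_eq hx.consistent hy.consistent hxy a ha)]

/-- The word `w` as a set of pasts: those that end with `w`. -/
def wordSet (w : List A) : Set (ℕ → A) := {x | ∀ i : Fin w.length, x (w.length - 1 - i) = w.get i}

lemma endsWith_eq (X : ℤ → Ω → A) (t : ℤ) (w : List A) :
    endsWith X t w = past X t ⁻¹' wordSet w := by
  ext ω
  refine forall_congr' fun i => ?_
  have hi := i.2
  have : t - w.length + (i : ℕ) = t - 1 - ((w.length - 1 - i : ℕ) : ℤ) := by omega
  rw [this]
  rfl

lemma measurableSet_wordSet (w : List A) : MeasurableSet (wordSet w) := by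
  have : wordSet w = ⋂ i : Fin w.length, {x | x (w.length - 1 - i) = w.get i} := by
    ext x
    simp [wordSet]
  rw [this]
  exact MeasurableSet.iInter fun i => measurable_pi_apply _ (measurableSet_singleton _)

@[simp] lemma wordSet_nil : wordSet ([] : List A) = Set.univ :=
  Set.eq_univ_of_forall fun _ i => i.elim0

/-- Words are read forward but pasts are indexed backward, so the last letter of a word is
coordinate `0` of the past. -/
lemma cons_mem_wordSet_append {w : List A} {a b : A} {x : ℕ → A} :
    cons b x ∈ wordSet (w ++ [a]) ↔ b = a ∧ x ∈ wordSet w := by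
  constructor
  · intro h
    refine ⟨?_, fun i => ?_⟩
    · have := h ⟨w.length, by simp⟩
      simpa using this
    · have hi := i.2
      have := h ⟨i, by simp⟩
      have e : (w ++ [a]).length - 1 - (i : ℕ) = (w.length - 1 - i) + 1 := by simp; omega
      rw [e, cons_succ] at this
      rw [this]
      simp
  · rintro ⟨rfl, h⟩ ⟨i, hi⟩
    rw [List.length_append, List.length_singleton] at hi
    rcases Nat.lt_succ_iff_lt_or_eq.1 hi with hi' | rfl
    · have e : (w ++ [b]).length - 1 - i = (w.length - 1 - i) + 1 := by simp; omega
      change cons b x ((w ++ [b]).length - 1 - i) = _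
      rw [e, cons_succ, h ⟨i, hi'⟩]
      simp [List.getElem_append_left hi']
    · simp

lemma nextMean_indicator_wordSet (w : List A) (a : A) (φ : (ℕ → A) → ℝ) (x : ℕ → A) :
    nextMean κ ((wordSet (w ++ [a])).indicator φ) x =
      (wordSet w).indicator (fun x => (nextLaw κ x).real {a} * φ (cons a x)) x := by
  classical
  rw [nextMean_eq_sum, Finset.sum_eq_single a]
  · by_cases hx : x ∈ wordSet w
    · rw [Set.indicator_of_mem (cons_mem_wordSet_append.2 ⟨rfl, hx⟩), Set.indicator_of_mem hx]
    · rw [Set.indicator_of_notMem (fun h => hx (cons_mem_wordSet_append.1 h).2),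
        Set.indicator_of_notMem hx, mul_zero]
  · intro b _ hb
    rw [Set.indicator_of_notMem (fun h => hb (cons_mem_wordSet_append.1 h).1), mul_zero]
  · simp

lemma abs_indicator_stateFun_le (s : Set (ℕ → A)) (h : State P X κ → ℝ) (x : ℕ → A) :
    |s.indicator (stateFun h) x| ≤ ∑ σ, |h σ| := by
  refine le_trans ?_ (abs_stateFun_le h x)
  by_cases hx : x ∈ s
  · rw [Set.indicator_of_mem hx]
  · rw [Set.indicator_of_notMem hx, abs_zero]
    exact abs_nonneg _

/-! ### The Markov chain of causal states and the rates of words -/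

section Transition

variable (hX : ∀ t, Measurable (X t)) (hκ : IsPredictiveKernel P X κ)
  (hfin : FinitelyManyCausalStates P X κ)

include hX hκ hfin

/-- A causal state has positive probability at some time, hence contains a regular past. Evaluating
at such a representative makes quantities attached to pasts functions of the state. -/
lemma exists_regular_section :
    ∃ rep : State P X κ → ℕ → A, ∀ σ, causalState κ (rep σ) = σ ∧ IsRegular P X κ (rep σ) := by
  choose rep h using fun σ : State P X κ => σ.2.exists_of_ae hX (ae_isRegular hX hκ hfin)
  exact ⟨rep, h⟩

/-- Conditioning on the next symbol maps functions of the state to functions of the state. -/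
lemma exists_stateFun_step (h : State P X κ → ℝ) (a : A) :
    ∃ h' : State P X κ → ℝ, ((∀ σ, 0 ≤ h σ) → ∀ σ, 0 ≤ h' σ) ∧
      ∀ᵐ x ∂pastLaw P X, (nextLaw κ x).real {a} * stateFun h (cons a x) = stateFun h' x := by
  obtain ⟨rep, hrep⟩ := exists_regular_section (κ := κ) hX hκ hfin
  refine ⟨fun σ => (nextLaw κ (rep σ)).real {a} * stateFun h (cons a (rep σ)),
    fun h0 σ => mul_nonneg measureReal_nonneg (stateFun_nonneg h0 _), ?_⟩
  filter_upwards [ae_isRegular hX hκ hfin] with x hx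
  obtain ⟨h1, h2⟩ := hrep ⟨_, hx.isCausalState⟩
  rw [stateFun_eq _ (σ := ⟨_, hx.isCausalState⟩) rfl]
  exact hx.nextLaw_mul_stateFun_congr h2 h (kernel_eq_of_causalState_eq h1).symm a

/-- The transition matrix of the process of causal states. -/
lemma exists_transition (hirr : CausalStatesIrreducible P X κ) :
    ∃ q : State P X κ → State P X κ → ℝ, (∀ σ τ, 0 ≤ q σ τ) ∧ (∀ σ, ∑ τ, q σ τ = 1) ∧
      (∀ R : Set (State P X κ), R.Nonempty → (∀ σ ∈ R, ∀ τ, 0 < q σ τ → τ ∈ R) → R = Set.univ) ∧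
      ∀ u : State P X κ → ℝ, ∀ᵐ x ∂pastLaw P X,
        nextMean κ (stateFun u) x = stateFun (fun σ => ∑ τ, q σ τ * u τ) x := by
  classical
  obtain ⟨rep, hrep⟩ := exists_regular_section (κ := κ) hX hκ hfin
  have hsingle : ∀ u : State P X κ → ℝ, ∀ x, stateFun u x =
      ∑ τ, stateFun (Pi.single τ (1 : ℝ)) x * u τ := by
    intro u x
    simp only [stateFun, Finset.sum_mul]
    rw [Finset.sum_comm]
    refine Finset.sum_congr rfl fun σ _ => ?_
    rw [Finset.sum_eq_single σ]
    · by_cases hx : x ∈ σ.1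
      · simp [Set.indicator_of_mem hx]
      · simp [Set.indicator_of_notMem hx]
    · intro τ _ hτ
      by_cases hx : x ∈ σ.1
      · simp [Set.indicator_of_mem hx, Pi.single_eq_of_ne hτ.symm]
      · simp [Set.indicator_of_notMem hx]
    · simp
  set q : State P X κ → State P X κ → ℝ := fun σ τ =>
    ∑ a, (nextLaw κ (rep σ)).real {a} * stateFun (Pi.single τ (1 : ℝ)) (cons a (rep σ)) with hq
  have hsum : ∀ (u : State P X κ → ℝ) σ, ∑ τ, q σ τ * u τ =
      ∑ a, (nextLaw κ (rep σ)).real {a} * stateFun u (cons a (rep σ)) := by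
    intro u σ
    simp only [hq, Finset.sum_mul]
    rw [Finset.sum_comm]
    refine Finset.sum_congr rfl fun a _ => ?_
    rw [hsingle u, Finset.mul_sum]
    exact Finset.sum_congr rfl fun τ _ => by ring
  have hnn : ∀ (σ τ : State P X κ) (a : A), 0 ≤ (nextLaw κ (rep σ)).real {a} *
      stateFun (Pi.single τ (1 : ℝ)) (cons a (rep σ)) := by
    intro σ τ a
    have h0 : (0 : State P X κ → ℝ) ≤ Pi.single τ 1 := Pi.single_nonneg.2 zero_le_one
    exact mul_nonneg measureReal_nonneg (stateFun_nonneg h0 _)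
  refine ⟨q, fun σ τ => Finset.sum_nonneg fun a _ => hnn σ τ a, fun σ => ?_, ?_, fun u => ?_⟩
  · have h := hsum (fun _ => 1) σ
    simp only [mul_one] at h
    rw [h]
    have h1 : ∑ a, (nextLaw κ (rep σ)).real {a} * (1 : ℝ) = 1 := by
      rw [← integral_fintype']
      simp
    -- Regularity ensures that every letter of positive probability leads to a genuine causal state,
    -- so no mass is lost.
    refine Eq.trans (Finset.sum_congr rfl fun a _ => ?_) h1
    by_cases ha : nextLaw κ (rep σ) {a} = 0
    · simp [Measure.real, ha]
    · rw [stateFun_eq _ (σ := ⟨_, (hrep σ).2.isCausalState_cons a ha⟩) rfl]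
  · rintro R ⟨σ, hσ⟩ hR
    refine Set.eq_univ_of_forall fun τ => ?_
    obtain ⟨t, n, htn⟩ := hirr σ τ σ.2 τ.2
    -- A set closed under positive transitions is almost surely never left. Hence a state reachable
    -- from a member of `R` with positive probability belongs to `R`.
    have hstep : ∀ s : ℤ, ∀ᵐ ω ∂P, stateAt X κ s ω ∈ Subtype.val '' R →
        stateAt X κ (s + 1) ω ∈ Subtype.val '' R := by
      intro s
      have hpos : ∀ᵐ ω ∂P, nextLaw κ (past X s ω) {X s ω} ≠ 0 := by
        refine ae_next (p := fun x a => nextLaw κ x {a} ≠ 0) hX hκ ?_ ?_ s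
        · have : {q : (ℕ → A) × A | nextLaw κ q.1 {q.2} ≠ 0} =
              ⋃ a : A, {x | nextLaw κ x {a} ≠ 0} ×ˢ {a} := by
            ext ⟨x, a⟩
            simp
          rw [this]
          exact MeasurableSet.iUnion fun a => (((nextLaw κ).measurable_coe
            (measurableSet_singleton a)) (measurableSet_singleton 0).compl).prod
            (measurableSet_singleton a)
        · exact Eventually.of_forall fun x => ae_iff_forall_of_fintype.2 fun a ha => ha
      filter_upwards [hpos, ae_past hX (ae_isRegular hX hκ hfin) s] with ω h1 h2 h3
      obtain ⟨ρ, hρ, hρ'⟩ := h3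
      have hrρ := hrep ρ
      have hκeq : κ (past X s ω) = κ (rep ρ) :=
        kernel_eq_of_causalState_eq (hρ'.symm.trans hrρ.1.symm)
      have ha : nextLaw κ (rep ρ) {X s ω} ≠ 0 := nextLaw_congr hκeq ▸ h1
      have hcs := hrρ.2.isCausalState_cons _ ha
      have hnext : stateAt X κ (s + 1) ω = causalState κ (cons (X s ω) (rep ρ)) := by
        rw [stateAt, past_succ]
        exact causalState_congr (kernel_cons_eq h2.consistent hrρ.2.consistent hκeq _ h1)
      rw [hnext]
      refine ⟨⟨_, hcs⟩, hR ρ hρ _ (Finset.sum_pos' (fun a _ => hnn _ _ a)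
        ⟨X s ω, Finset.mem_univ _, mul_pos ?_ ?_⟩), rfl⟩
      · exact ENNReal.toReal_pos ha (measure_ne_top _ _)
      · rw [stateFun_eq _ (σ := ⟨_, hcs⟩) rfl]
        simp
    have hall : ∀ n : ℕ, ∀ᵐ ω ∂P, stateAt X κ t ω = σ →
        stateAt X κ (t + n) ω ∈ Subtype.val '' R := by
      intro n
      induction n with
      | zero => exact Eventually.of_forall fun ω hω => by simpa [hω] using ⟨σ.2, hσ⟩
      | succ n ih =>
        filter_upwards [ih, hstep (t + n)] with ω h1 h2 h3
        have := h2 (h1 h3)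
        rwa [add_assoc] at this
    by_contra hτ
    refine htn (measure_mono_null (fun ω hω => ?_) (ae_iff.1 (hall n)))
    simp only [Set.mem_ofPred_eq] at hω ⊢
    rw [hω.2]
    intro hc
    obtain ⟨ρ, hρ, hρ'⟩ := hc hω.1
    exact hτ (Subtype.ext hρ' ▸ hρ)
  · filter_upwards [ae_isRegular hX hκ hfin] with x hx
    obtain ⟨h1, h2⟩ := hrep ⟨_, hx.isCausalState⟩
    rw [stateFun_eq _ (σ := ⟨_, hx.isCausalState⟩) rfl, hsum, nextMean_eq_sum]
    exact Finset.sum_congr rfl fun a _ =>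
      hx.nextLaw_mul_stateFun_congr h2 u (kernel_eq_of_causalState_eq h1).symm a

lemma nonempty_state : Nonempty (State P X κ) := by
  obtain ⟨ω, hω⟩ := (ae_isCausalState_stateAt hfin 0).exists
  exact ⟨⟨_, hω⟩⟩

/-- The quantifier over `h` is inside the induction because removing the last letter changes `h`.
The rate is unchanged at each removal; for the empty word it is the constant of the Poisson
equation. -/
lemma exists_rate_indicator_stateFun (hirr : CausalStatesIrreducible P X κ) (w : List A) :
    ∀ h : State P X κ → ℝ, ∃ c : ℝ,
      Negligible P (fun N ω => pastSum X ((wordSet w).indicator (stateFun h)) N ω - N * c) ∧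
      ((∀ σ, 0 ≤ h σ) → (∃ t, ∫ ω, (wordSet w).indicator (stateFun h) (past X t ω) ∂P ≠ 0) →
        0 < c) := by
  induction w using List.reverseRecOn with
  | nil =>
    intro h
    have := nonempty_state (κ := κ) hX hκ hfin
    obtain ⟨q, h0, h1, hq, hstep⟩ := exists_transition hX hκ hfin hirr
    obtain ⟨c, u, hu⟩ := exists_poisson h0 h1 hq h
    refine ⟨c, ?_, fun hh ⟨t, ht⟩ => poisson_pos h0 h1 hq hu hh ?_⟩
    · have hmain := negligible_pastSum_sub_nextMean hX hκ (measurable_stateFun u)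
        (abs_stateFun_le u)
      have hae : ∀ᵐ x ∂pastLaw P X, (wordSet ([] : List A)).indicator (stateFun h) x - c =
          stateFun u x - nextMean κ (stateFun u) x := by
        filter_upwards [hstep u, ae_isRegular hX hκ hfin] with x hx hreg
        rw [hx, wordSet_nil, Set.indicator_univ,
          stateFun_eq _ (σ := ⟨_, hreg.isCausalState⟩) rfl,
          stateFun_eq _ (σ := ⟨_, hreg.isCausalState⟩) rfl,
          stateFun_eq _ (σ := ⟨_, hreg.isCausalState⟩) rfl, hu]
        ring
      refine hmain.congr_ae fun N => ?_
      filter_upwards [pastSum_congr_ae hX hae N] with ω hω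
      simp only [pastSum, Finset.sum_sub_distrib, Finset.sum_const, Finset.card_range,
        nsmul_eq_mul] at hω ⊢
      exact hω.symm
    · by_contra! hz
      refine ht ?_
      simp [stateFun, hz]
  | append_singleton w a ih =>
    intro h
    obtain ⟨h', hnn, hh'⟩ := exists_stateFun_step hX hκ hfin h a
    obtain ⟨c, hc, hpos⟩ := ih h'
    have hae : ∀ᵐ x ∂pastLaw P X, nextMean κ ((wordSet (w ++ [a])).indicator (stateFun h)) x =
        (wordSet w).indicator (stateFun h') x := by
      classical
      filter_upwards [hh'] with x hx
      rw [nextMean_indicator_wordSet, Set.indicator_apply, Set.indicator_apply, hx]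
    have hm := (measurable_stateFun h).indicator (measurableSet_wordSet (w ++ [a]))
    have hb := abs_indicator_stateFun_le (wordSet (w ++ [a])) h
    -- Taking conditional expectations preserves the mean but moves the time from `t` to `t - 1`.
    refine ⟨c, ?_, fun h0 ⟨t, ht⟩ => hpos (hnn h0) ⟨t - 1, ?_⟩⟩
    · refine ((negligible_pastSum_sub_nextMean hX hκ hm hb).add hc).congr_ae fun N => ?_
      filter_upwards [pastSum_congr_ae hX hae N] with ω hω
      rw [hω]
      ring
    · have := integral_past_succ hX hκ hm hb (t - 1)
      rw [sub_add_cancel] at this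
      rw [this] at ht
      rwa [integral_congr_ae (ae_past hX hae (t - 1))] at ht

/-- Every word has a rate of occurrence, which is positive if the word is possible. -/
lemma exists_wordRate (hirr : CausalStatesIrreducible P X κ) (w : List A) :
    ∃ c : ℝ, Negligible P (fun N ω => pastSum X ((wordSet w).indicator 1) N ω - N * c) ∧
      (IsPossible P X w → 0 < c) := by
  obtain ⟨c, hc, hpos⟩ := exists_rate_indicator_stateFun hX hκ hfin hirr w (fun _ => 1)
  have hae : ∀ᵐ x ∂pastLaw P X, (wordSet w).indicator (stateFun fun _ : State P X κ => 1) x =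
      (wordSet w).indicator 1 x := by
    classical
    filter_upwards [ae_isRegular hX hκ hfin] with x hx
    rw [Set.indicator_apply, Set.indicator_apply,
      stateFun_eq _ (σ := ⟨_, hx.isCausalState⟩) rfl, Pi.one_apply]
  refine ⟨c, hc.congr_ae fun N => ?_, fun ⟨t, ht⟩ => hpos (fun _ => zero_le_one) ⟨t, ?_⟩⟩
  · filter_upwards [pastSum_congr_ae hX hae N] with ω hω
    rw [hω]
  · rw [integral_congr_ae (ae_past hX hae t)]
    have : (fun ω => (wordSet w).indicator (1 : (ℕ → A) → ℝ) (past X t ω)) =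
        (endsWith X t w).indicator 1 := by
      funext ω
      rw [endsWith_eq]
      rfl
    rw [this, integral_indicator_one (by
      rw [endsWith_eq]
      exact measurable_past hX t (measurableSet_wordSet w))]
    exact (ENNReal.toReal_pos ht (measure_ne_top _ _)).ne'

end Transition

end States

/-! ### Counts in the data and long-run word probabilities -/

section Counts

variable {A Ω : Type*} [Fintype A] [MeasurableSpace A] [MeasurableSingletonClass A]
  [MeasurableSpace Ω]
variable {P : Measure Ω} [IsProbabilityMeasure P] {X : ℤ → Ω → A} {κ : Kernel (ℕ → A) (ℕ → A)}
  [IsMarkovKernel κ]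

/-- The number of times `t < N` at which the past belongs to `V t`. -/
def visits (X : ℤ → Ω → A) (V : ℕ → Set (ℕ → A)) (N : ℕ) (ω : Ω) : ℝ :=
  ∑ t ∈ Finset.range N, (V t).indicator 1 (past X t ω)

/-- The number of times `t < N` at which the past belongs to `V t` and the next symbol is `a`. -/
def visitsNext (X : ℤ → Ω → A) (V : ℕ → Set (ℕ → A)) (N : ℕ) (a : A) (ω : Ω) : ℝ :=
  ∑ t ∈ Finset.range N, (V t).indicator 1 (past X t ω) * ({a} : Set A).indicator 1 (X t ω)

/-- The pasts at time `t` that end with `w` and contain this occurrence after time `0`. -/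
def occSet (w : List A) (t : ℕ) : Set (ℕ → A) := {x | w.length ≤ t ∧ x ∈ wordSet w}

lemma measurableSet_occSet (w : List A) (t : ℕ) : MeasurableSet (occSet w t) :=
  (MeasurableSet.const _).inter (measurableSet_wordSet w)

lemma indicator_one_nonneg {E : Type*} (s : Set E) (x : E) : 0 ≤ s.indicator (1 : E → ℝ) x :=
  Set.indicator_nonneg (fun _ _ => zero_le_one) x

lemma indicator_one_le_one {E : Type*} (s : Set E) (x : E) : s.indicator (1 : E → ℝ) x ≤ 1 :=
  Set.indicator_le_self' (f := (1 : E → ℝ)) (fun _ _ => zero_le_one) x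

lemma measurable_visits (hX : ∀ t, Measurable (X t)) {V : ℕ → Set (ℕ → A)}
    (hV : ∀ t, MeasurableSet (V t)) (N : ℕ) : Measurable (visits X V N) :=
  Finset.measurable_sum _ fun t _ => (measurable_one.indicator (hV t)).comp (measurable_past hX t)

lemma count_eq_visits (N : ℕ) (w : List A) (ω : Ω) :
    (count X N w ω : ℝ) = visits X (occSet w) N ω := by
  classical
  rw [count, visits, Finset.card_filter]
  push_cast
  refine Finset.sum_congr rfl fun t _ => ?_
  rw [Set.indicator_apply, endsWith_eq]
  exact if_congr Iff.rfl rfl rfl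

lemma countNext_eq_visitsNext (N : ℕ) (w : List A) (a : A) (ω : Ω) :
    (countNext X N w a ω : ℝ) = visitsNext X (occSet w) N a ω := by
  classical
  rw [countNext, visitsNext, Finset.card_filter]
  push_cast
  refine Finset.sum_congr rfl fun t _ => ?_
  rw [Set.indicator_apply, Set.indicator_apply, endsWith_eq, Pi.one_apply, Pi.one_apply,
    ite_zero_mul_ite_zero, one_mul]
  exact if_congr (by rw [← and_assoc]; exact Iff.rfl) rfl rfl

/-- A visit to `w` at time `t` followed by `a` is an occurrence of `w ++ [a]` ending one step later.
The shift adds time `N`; time `0` contributes nothing as `w ++ [a]` is nonempty. -/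
lemma visitsNext_occSet (N : ℕ) (w : List A) (a : A) (ω : Ω) :
    visitsNext X (occSet w) N a ω = visits X (occSet (w ++ [a])) N ω +
      (occSet (w ++ [a]) N).indicator 1 (past X N ω) := by
  classical
  rw [visits, ← Finset.sum_range_succ (fun t : ℕ => (occSet (w ++ [a]) t).indicator
    (1 : (ℕ → A) → ℝ) (past X t ω)), Finset.sum_range_succ', visitsNext]
  have h0 : (occSet (w ++ [a]) 0).indicator (1 : (ℕ → A) → ℝ) (past X (0 : ℕ) ω) = 0 :=
    Set.indicator_of_notMem (fun h => by simpa using h.1) _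
  rw [h0, add_zero]
  refine Finset.sum_congr rfl fun t _ => ?_
  rw [Set.indicator_apply, Set.indicator_apply, Set.indicator_apply, Pi.one_apply, Pi.one_apply,
    Pi.one_apply, ite_zero_mul_ite_zero, one_mul]
  refine if_congr ?_ rfl rfl
  push_cast
  rw [past_succ]
  simp only [occSet, Set.mem_ofPred_eq, cons_mem_wordSet_append, List.length_append,
    List.length_singleton, Set.mem_singleton_iff, add_le_add_iff_right]
  tauto

lemma sum_visitsNext (V : ℕ → Set (ℕ → A)) (N : ℕ) (ω : Ω) :
    ∑ a, visitsNext X V N a ω = visits X V N ω := by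
  classical
  simp only [visitsNext, visits]
  rw [Finset.sum_comm]
  refine Finset.sum_congr rfl fun t _ => ?_
  rw [← Finset.mul_sum]
  simp [Set.indicator_apply]

/-- A word occurs in the data as often as among the pasts, up to the initial times. -/
lemma abs_visits_occSet_sub_le (w : List A) (N : ℕ) (ω : Ω) :
    |visits X (occSet w) N ω - pastSum X ((wordSet w).indicator 1) N ω| ≤ w.length := by
  classical
  rw [visits, pastSum, ← Finset.sum_sub_distrib]
  refine (Finset.abs_sum_le_sum_abs _ _).trans ?_
  calc _ ≤ ∑ t ∈ Finset.range N, if t < w.length then (1 : ℝ) else 0 := by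
        refine Finset.sum_le_sum fun t _ => ?_
        by_cases ht : t < w.length
        · rw [if_pos ht, Set.indicator_of_notMem (fun h => absurd h.1 (not_le.2 ht)), zero_sub,
            abs_neg, abs_of_nonneg (indicator_one_nonneg _ _)]
          exact indicator_one_le_one _ _
        · rw [if_neg ht]
          have : (past X t ω ∈ occSet w t) ↔ past X t ω ∈ wordSet w := by
            simp [occSet, not_lt.1 ht]
          simp only [Set.indicator_apply, this, sub_self, abs_zero, le_refl]
    _ = (((Finset.range N).filter (· < w.length)).card : ℝ) := by
        rw [Finset.sum_boole]
    _ ≤ _ := by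
        have : ((Finset.range N).filter (· < w.length)).card ≤ (Finset.range w.length).card :=
          Finset.card_le_card fun t ht => by simpa using (Finset.mem_filter.1 ht).2
        rw [Finset.card_range] at this
        exact_mod_cast this

lemma avgWordProb_eq (hX : ∀ t, Measurable (X t)) (w : List A) (N : ℕ) :
    avgWordProb P X w N = (∫ ω, pastSum X ((wordSet w).indicator 1) N ω ∂P) / N := by
  have hm : ∀ t : ℕ, MeasurableSet (endsWith X t w) := fun t => by
    rw [endsWith_eq]
    exact measurable_past hX t (measurableSet_wordSet w)
  have h : ∀ t : ℕ, (fun ω => (wordSet w).indicator (1 : (ℕ → A) → ℝ) (past X t ω)) =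
      (endsWith X t w).indicator 1 := fun t => by
    funext ω
    rw [endsWith_eq]
    rfl
  simp only [avgWordProb, pastSum]
  rw [integral_finsetSum]
  · congr 1
    refine Finset.sum_congr rfl fun t _ => ?_
    rw [h, integral_indicator_one (hm t)]
  · intro t _
    rw [h]
    exact (integrable_const (1 : ℝ)).indicator (hm t)

lemma integrable_pastSum_wordSet (hX : ∀ t, Measurable (X t)) (w : List A) (N : ℕ) :
    Integrable (pastSum X ((wordSet w).indicator 1) N) P :=
  integrable_finsetSum _ fun t _ => Integrable.of_bound
    ((measurable_one.indicator (measurableSet_wordSet w)).comp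
      (measurable_past hX t)).aestronglyMeasurable 1 (Eventually.of_forall fun ω => by
        rw [Real.norm_of_nonneg (indicator_one_nonneg _ _)]
        exact indicator_one_le_one _ _)

lemma wordProb_of_negligible (hX : ∀ t, Measurable (X t)) {w : List A} {c : ℝ}
    (h : Negligible P (fun N ω => pastSum X ((wordSet w).indicator 1) N ω - N * c)) :
    Tendsto (avgWordProb P X w) atTop (𝓝 (wordProb P X w)) ∧ wordProb P X w = c := by
  have ht : Tendsto (avgWordProb P X w) atTop (𝓝 c) := by
    have h1 := h.tendsto_mean.add_const c
    rw [zero_add] at h1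
    refine h1.congr' ?_
    filter_upwards [eventually_gt_atTop 0] with N hN
    have hN' : (N : ℝ) ≠ 0 := by exact_mod_cast hN.ne'
    rw [avgWordProb_eq hX, integral_sub (integrable_pastSum_wordSet hX w N) (integrable_const _)]
    simp only [integral_const, probReal_univ, one_smul]
    field_simp
    ring
  have he : wordProb P X w = c := ht.limUnder_eq
  exact ⟨he ▸ ht, he⟩

lemma negligible_count_of_negligible (hX : ∀ t, Measurable (X t)) {w : List A} {c : ℝ}
    (h : Negligible P (fun N ω => pastSum X ((wordSet w).indicator 1) N ω - N * c)) :
    Negligible P (fun N ω => (count X N w ω : ℝ) - N * c) := by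
  have hb := Negligible.of_bounded (P := P) (Z := fun N ω => visits X (occSet w) N ω -
    pastSum X ((wordSet w).indicator 1) N ω) (fun N => (measurable_visits hX
      (measurableSet_occSet w) N).sub (measurable_pastSum hX
        (measurable_one.indicator (measurableSet_wordSet w)) N)) (abs_visits_occSet_sub_le w)
  refine (hb.add h).congr_ae fun N => Eventually.of_forall fun ω => ?_
  simp only [count_eq_visits]
  ring

lemma negligible_countNext_of_negligible (hX : ∀ t, Measurable (X t)) {w : List A} {a : A} {c : ℝ}
    (h : Negligible P (fun N ω => (count X N (w ++ [a]) ω : ℝ) - N * c)) :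
    Negligible P (fun N ω => (countNext X N w a ω : ℝ) - N * c) := by
  have hb := Negligible.of_bounded (P := P) (b := 1)
    (Z := fun N ω => (occSet (w ++ [a]) N).indicator (1 : (ℕ → A) → ℝ) (past X N ω))
    (fun N => (measurable_one.indicator (measurableSet_occSet _ N)).comp (measurable_past hX N))
    (fun N ω => by
      rw [abs_of_nonneg (indicator_one_nonneg _ _)]
      exact indicator_one_le_one _ _)
  refine (h.add hb).congr_ae fun N => Eventually.of_forall fun ω => ?_
  simp only [count_eq_visits, countNext_eq_visitsNext, visitsNext_occSet]
  ring

lemma wordProb_mem_Icc {w : List A}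
    (h : Tendsto (avgWordProb P X w) atTop (𝓝 (wordProb P X w))) :
    0 ≤ wordProb P X w ∧ wordProb P X w ≤ 1 := by
  refine ⟨ge_of_tendsto' h fun N => ?_, le_of_tendsto' h fun N => ?_⟩
  · exact div_nonneg (Finset.sum_nonneg fun _ _ => measureReal_nonneg) (Nat.cast_nonneg _)
  · refine div_le_one_of_le₀ ?_ (Nat.cast_nonneg _)
    refine (Finset.sum_le_card_nsmul _ _ 1 fun _ _ => measureReal_le_one).trans ?_
    simp

/-! ### Deviation of empirical morphs at a random number of visits -/

section Morph

/-- The estimated morph after the visits to the sets `V t`, at which the law of the next symbol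
is `q`, is unlikely to be far from `q` when there have been many visits. -/
lemma measureReal_varDist_ge_le (hX : ∀ t, Measurable (X t)) (hκ : IsPredictiveKernel P X κ)
    {V : ℕ → Set (ℕ → A)} (hV : ∀ t, MeasurableSet (V t)) {q : A → ℝ} (hq1 : ∑ a, q a = 1)
    (hq : ∀ t, ∀ᵐ x ∂pastLaw P X, x ∈ V t → ∀ a, (nextLaw κ x).real {a} = q a)
    (N : ℕ) {n₀ s : ℝ} (hs : 0 < s) :
    P.real {ω | n₀ ≤ visits X V N ω ∧ 0 < visits X V N ω ∧
      s ≤ varDist (fun a => visitsNext X V N a ω / visits X V N ω) q} ≤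
      2 ^ Fintype.card A * Real.exp (-(n₀ * s ^ 2 / 2)) := by
  classical
  -- Hoeffding's lemma for a variable in `[0, 1]` with parameter `2 * s` costs `s ^ 2 / 2` per
  -- visit; off the visits the increment is zero, so the random number of visits does no harm.
  set d : Finset A → ℕ → (ℕ → A) → A → ℝ := fun B t x a => (V t).indicator 1 x *
    (2 * s * ((B : Set A).indicator 1 a - ∑ b ∈ B, q b) - s ^ 2 / 2) with hd
  have hdm : ∀ B t, Measurable (fun p : (ℕ → A) × A => d B t p.1 p.2) := fun B t =>
    ((measurable_one.indicator (hV t)).comp measurable_fst).mul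
      (((((measurable_one.indicator B.measurableSet).comp measurable_snd).sub_const _).const_mul
        _).sub_const _)
  have hexp : ∀ B t, ∀ᵐ x ∂pastLaw P X,
      ∫⁻ a, ENNReal.ofReal (Real.exp (d B t x a)) ∂nextLaw κ x ≤ 1 := by
    intro B t
    filter_upwards [hq t] with x hx
    by_cases hxV : x ∈ V t
    · have h := lintegral_exp_sub_integral_le (nextLaw κ x) (Y := (B : Set A).indicator 1)
        (measurable_one.indicator B.measurableSet) zero_le_one
        (fun a => ⟨indicator_one_nonneg _ _, indicator_one_le_one _ _⟩) (2 * s)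
      have hint : ∫ a, (B : Set A).indicator (1 : A → ℝ) a ∂nextLaw κ x = ∑ b ∈ B, q b := by
        rw [integral_fintype', ← Finset.sum_filter_add_sum_filter_not _ (· ∈ B)]
        rw [Finset.sum_eq_zero (s := Finset.univ.filter (¬ · ∈ B)) fun a ha => by
          simp [(Finset.mem_filter.1 ha).2]]
        rw [add_zero, Finset.filter_mem_eq_inter, Finset.univ_inter]
        exact Finset.sum_congr rfl fun b hb => by simp [hb, hx hxV]
      rw [hint] at h
      refine le_trans (le_of_eq ?_) h
      refine lintegral_congr fun a => ?_
      simp only [hd, Set.indicator_of_mem hxV, Pi.one_apply, one_mul]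
      congr 2
      ring
    · simp [hd, Set.indicator_of_notMem hxV]
  -- The set of overestimated letters depends on `ω`, whence the union over all `2 ^ k` subsets.
  have hsub : {ω | n₀ ≤ visits X V N ω ∧ 0 < visits X V N ω ∧
      s ≤ varDist (fun a => visitsNext X V N a ω / visits X V N ω) q} ⊆
      ⋃ B ∈ (Finset.univ : Finset (Finset A)), {ω | n₀ * s ^ 2 / 2 ≤
        ∑ t ∈ Finset.range N, d B t (past X t ω) (X t ω)} := by
    rintro ω ⟨h1, h2, h3⟩
    set n := visits X V N ω with hn
    set δ : A → ℝ := fun a => visitsNext X V N a ω / n - q a with hδ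
    have hδ0 : ∑ a, δ a = 0 := by
      rw [hδ, Finset.sum_sub_distrib, hq1, ← Finset.sum_div, sum_visitsNext, div_self h2.ne',
        sub_self]
    set B : Finset A := Finset.univ.filter (0 ≤ δ ·) with hB
    -- The errors sum to zero, so the positive ones carry half of the distance.
    have hhalf : s / 2 ≤ ∑ a ∈ B, δ a := by
      have e1 := Finset.sum_filter_add_sum_filter_not Finset.univ (0 ≤ δ ·) δ
      have e2 := Finset.sum_filter_add_sum_filter_not Finset.univ (0 ≤ δ ·) (fun a => |δ a|)
      rw [Finset.sum_congr rfl fun a ha => abs_of_nonneg (Finset.mem_filter.1 ha).2,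
        Finset.sum_congr rfl (s₁ := Finset.univ.filter (¬ 0 ≤ δ ·)) fun a ha =>
          abs_of_neg (not_le.1 (Finset.mem_filter.1 ha).2), Finset.sum_neg_distrib] at e2
      have h3' : s ≤ ∑ a, |δ a| := h3
      rw [← hB] at e1 e2
      linarith
    simp only [Set.mem_iUnion, Finset.mem_univ, exists_true_left, Set.mem_ofPred_eq]
    refine ⟨B, ?_⟩
    have hsum : ∑ t ∈ Finset.range N, d B t (past X t ω) (X t ω) =
        2 * s * (n * ∑ a ∈ B, δ a) - n * (s ^ 2 / 2) := by
      have e : n * ∑ a ∈ B, δ a = ∑ t ∈ Finset.range N, (V t).indicator 1 (past X t ω) *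
          (B : Set A).indicator 1 (X t ω) - n * ∑ b ∈ B, q b := by
        rw [hδ, Finset.sum_sub_distrib, mul_sub, ← Finset.sum_div, mul_div_cancel₀ _ h2.ne']
        congr 1
        simp only [visitsNext]
        rw [Finset.sum_comm]
        refine Finset.sum_congr rfl fun t _ => ?_
        rw [← Finset.mul_sum]
        congr 1
        simp [Set.indicator_apply]
      rw [e, hn, visits, mul_sub, Finset.mul_sum, Finset.sum_mul, Finset.mul_sum, Finset.sum_mul,
        ← Finset.sum_sub_distrib, ← Finset.sum_sub_distrib]
      refine Finset.sum_congr rfl fun t _ => ?_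
      simp only [hd]
      ring
    rw [hsum]
    have h4 : n * (s / 2) ≤ n * ∑ a ∈ B, δ a := mul_le_mul_of_nonneg_left hhalf h2.le
    have h5 : 2 * s * (n * (s / 2)) ≤ 2 * s * (n * ∑ a ∈ B, δ a) :=
      mul_le_mul_of_nonneg_left h4 (by positivity)
    have h6 : n₀ * s ^ 2 ≤ n * s ^ 2 := mul_le_mul_of_nonneg_right h1 (sq_nonneg s)
    linarith
  calc _ ≤ _ := measureReal_mono hsub (measure_ne_top _ _)
    _ ≤ ∑ B : Finset A, P.real {ω | n₀ * s ^ 2 / 2 ≤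
        ∑ t ∈ Finset.range N, d B t (past X t ω) (X t ω)} := measureReal_biUnion_finset_le _ _
    _ ≤ ∑ _B : Finset A, Real.exp (-(n₀ * s ^ 2 / 2)) :=
        Finset.sum_le_sum fun B _ => measureReal_le_exp_neg hX hκ (hdm B) (hexp B) N _
    _ = _ := by simp

lemma measureReal_fails_le (hX : ∀ t, Measurable (X t)) (hκ : IsPredictiveKernel P X κ)
    {V : ℕ → Set (ℕ → A)} (hV : ∀ t, MeasurableSet (V t)) {q : A → ℝ} (hq1 : ∑ a, q a = 1)
    (hq : ∀ t, ∀ᵐ x ∂pastLaw P X, x ∈ V t → ∀ a, (nextLaw κ x).real {a} = q a)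
    (N : ℕ) {p p₀ ε D s : ℝ} (hs : 0 < s) (hp : p₀ ≤ p)
    (hD : P.real {ω | ε < |visits X V N ω / N - p|} ≤ D) :
    P.real {ω | visits X V N ω = 0 ∨
      s ≤ varDist (fun a => visitsNext X V N a ω / visits X V N ω) q} ≤
      2 ^ (Fintype.card A + 1) * Real.exp (-N * (p₀ - ε) * s ^ 2 / 2) + D := by
  have hD0 : 0 ≤ D := measureReal_nonneg.trans hD
  -- If the guaranteed number of visits is not positive, the bound exceeds `1`. Otherwise, without a
  -- deviation of the count, something has been seen and only the distance can be at fault.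
  rcases le_or_gt (N * (p₀ - ε)) 0 with hle | hlt
  · have h1 : 1 ≤ Real.exp (-N * (p₀ - ε) * s ^ 2 / 2) := by
      refine Real.one_le_exp ?_
      have := mul_nonneg (neg_nonneg.2 hle) (sq_nonneg s)
      linarith
    have h2 : (1 : ℝ) ≤ 2 ^ (Fintype.card A + 1) := one_le_pow₀ one_le_two
    have := one_le_mul_of_one_le_of_one_le h2 h1
    exact measureReal_le_one.trans (by linarith)
  · have hN : (0 : ℝ) < N := by
      rcases Nat.eq_zero_or_pos N with rfl | h
      · simp at hlt
      · exact_mod_cast h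
    have h := measureReal_varDist_ge_le hX hκ hV hq1 hq N (n₀ := N * (p₀ - ε)) hs
    have hsub : {ω | visits X V N ω = 0 ∨
        s ≤ varDist (fun a => visitsNext X V N a ω / visits X V N ω) q} ⊆
        {ω | N * (p₀ - ε) ≤ visits X V N ω ∧ 0 < visits X V N ω ∧
          s ≤ varDist (fun a => visitsNext X V N a ω / visits X V N ω) q} ∪
        {ω | ε < |visits X V N ω / N - p|} := by
      intro ω hω
      by_cases hdev : ε < |visits X V N ω / N - p|
      · exact Or.inr hdev
      · left
        have h1 := (abs_le.1 (not_lt.1 hdev)).1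
        have h2 : p₀ - ε ≤ visits X V N ω / N := by linarith
        rw [le_div_iff₀ hN, mul_comm] at h2
        have h3 : 0 < visits X V N ω := hlt.trans_le h2
        exact ⟨h2, h3, hω.resolve_left h3.ne'⟩
    refine (measureReal_mono hsub).trans ((measureReal_union_le _ _).trans (add_le_add ?_ hD))
    refine h.trans ?_
    have he : -(N * (p₀ - ε) * s ^ 2 / 2) = -N * (p₀ - ε) * s ^ 2 / 2 := by ring
    rw [he]
    have := Real.exp_pos (-N * (p₀ - ε) * s ^ 2 / 2)
    exact mul_le_mul_of_nonneg_right (pow_le_pow_right₀ one_le_two (Nat.le_succ _)) this.le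

end Morph

end Counts

/-! ### Suffixes, their extensions and their morphs -/

section Words

variable {A Ω : Type*} [Fintype A] [MeasurableSpace A] [MeasurableSingletonClass A]
  [MeasurableSpace Ω]
variable {P : Measure Ω} [IsProbabilityMeasure P] {X : ℤ → Ω → A} {κ : Kernel (ℕ → A) (ℕ → A)}
  [IsMarkovKernel κ]

lemma IsCausalState.stateMorph_eq {σ : Set (ℕ → A)} (hσ : IsCausalState P X κ σ) {x : ℕ → A}
    (hx : causalState κ x = σ) (a : A) : (nextLaw κ x).real {a} = stateMorph κ σ a := by
  have hne : σ.Nonempty := ⟨x, hσ.mem_iff.2 hx⟩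
  have hκ : κ x = κ hne.some :=
    kernel_eq_of_causalState_eq (hx.trans (hσ.mem_iff.1 hne.some_mem).symm)
  rw [stateMorph, dif_pos hne, ← hκ, nextLaw_apply,
    map_measureReal_apply (measurable_pi_apply 0) (measurableSet_singleton a)]
  rfl

lemma IsCausalState.sum_stateMorph {σ : Set (ℕ → A)} (hσ : IsCausalState P X κ σ) :
    ∑ a, stateMorph κ σ a = 1 := by
  obtain ⟨x, hx⟩ := hσ.exists_eq
  have h : ∑ a, (nextLaw κ x).real {a} * (1 : ℝ) = 1 := by
    rw [← integral_fintype']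
    simp
  rw [← h]
  exact Finset.sum_congr rfl fun a _ => by rw [mul_one, hσ.stateMorph_eq hx.symm]

lemma IsSuffixIn.ae_mem (hX : ∀ t, Measurable (X t)) {w : List A} {σ : Set (ℕ → A)}
    (h : IsSuffixIn P X κ w σ) (hσ : IsCausalState P X κ σ) :
    ∀ᵐ x ∂pastLaw P X, x ∈ wordSet w → causalState κ x = σ := by
  refine ae_pastLaw_of_forall hX ?_ fun t => ?_
  · have : {x | x ∈ wordSet w → causalState κ x = σ} = (wordSet w)ᶜ ∪ σ := by
      ext x
      rw [Set.mem_union, Set.mem_compl_iff, hσ.mem_iff]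
      exact imp_iff_not_or
    rw [this]
    exact (measurableSet_wordSet w).compl.union hσ.measurableSet
  · filter_upwards [h.2 t] with ω hω hmem
    exact hω (by rw [endsWith_eq]; exact hmem)

lemma mem_stateWords {L : ℕ} {σ : Set (ℕ → A)} {u : Fin L → A} :
    u ∈ stateWords P X κ L σ ↔ IsSuffixIn P X κ (List.ofFn u) σ := by
  simp [stateWords]

/-- A past ends with `a :: w` iff it ends with `w` and the symbol before that is `a`. -/
lemma endsWith_cons (t : ℤ) (a : A) (w : List A) :
    endsWith X t (a :: w) = {ω | X (t - w.length - 1) ω = a} ∩ endsWith X t w := by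
  ext ω
  simp only [endsWith, Set.mem_ofPred_eq, Set.mem_inter_iff, List.length_cons]
  rw [Fin.forall_fin_succ]
  have e0 : t - ((w.length + 1 : ℕ) : ℤ) + ((0 : Fin (w.length + 1)) : ℕ) = t - w.length - 1 := by
    push_cast
    simp
    ring
  have e1 : ∀ i : Fin w.length, t - ((w.length + 1 : ℕ) : ℤ) + ((i.succ : Fin _) : ℕ) =
      t - w.length + (i : ℕ) := by
    intro i
    push_cast
    simp only [Fin.val_succ]
    push_cast
    ring
  simp only [e0, e1]
  rfl

/-- Prepending a letter shrinks the event, so the state stays determined; since finitely many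
letters exhaust the event, one of them keeps positive probability. -/
lemma IsSuffixIn.exists_cons {w : List A} {σ : Set (ℕ → A)}
    (h : IsSuffixIn P X κ w σ) : ∃ a, IsSuffixIn P X κ (a :: w) σ := by
  obtain ⟨⟨t, ht⟩, hae⟩ := h
  have hun : endsWith X t w = ⋃ a, endsWith X t (a :: w) := by
    ext ω
    simp [endsWith_cons]
  rw [hun, Ne, measure_iUnion_null_iff, not_forall] at ht
  obtain ⟨a, ha⟩ := ht
  refine ⟨a, ⟨t, ha⟩, fun s => ?_⟩
  filter_upwards [hae s] with ω hω hmem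
  rw [endsWith_cons] at hmem
  exact hω hmem.2

/-- `stateProb` sums over words of length exactly `L`; this makes the sum nonempty and hence
positive. -/
lemma IsSuffixIn.exists_stateWord {w : List A} {σ : Set (ℕ → A)}
    (h : IsSuffixIn P X κ w σ) {L : ℕ} (hL : w.length ≤ L) :
    ∃ u : Fin L → A, u ∈ stateWords P X κ L σ := by
  classical
  have key : ∀ n, ∃ v : List A, v.length = w.length + n ∧ IsSuffixIn P X κ v σ := by
    intro n
    induction n with
    | zero => exact ⟨w, rfl, h⟩
    | succ n ih =>
      obtain ⟨v, hv, hs⟩ := ih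
      obtain ⟨a, ha⟩ := hs.exists_cons
      exact ⟨a :: v, by rw [List.length_cons, hv]; rfl, ha⟩
  obtain ⟨v, hv, hs⟩ := key (L - w.length)
  rw [Nat.add_sub_cancel' hL] at hv
  subst hv
  refine ⟨v.get, ?_⟩
  rwa [mem_stateWords, List.ofFn_get]

section States

variable {L : ℕ}

/-- The last `L` symbols of a past, in the order of time. -/
def lastSymbols (L : ℕ) (x : ℕ → A) : Fin L → A := fun i => x (L - 1 - i)

lemma mem_wordSet_ofFn {u : Fin L → A} {x : ℕ → A} :
    x ∈ wordSet (List.ofFn u) ↔ lastSymbols L x = u := by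
  constructor
  · intro h
    funext i
    have := h ⟨i, by simp⟩
    simpa [lastSymbols] using this
  · rintro rfl i
    simp [lastSymbols]

/-- The pasts at time `t` that end with one of the words `W` of length `L`, all of it after
time `0`. -/
def occSetOf (W : Finset (Fin L → A)) (t : ℕ) : Set (ℕ → A) := {x | L ≤ t ∧ lastSymbols L x ∈ W}

lemma measurableSet_occSetOf (W : Finset (Fin L → A)) (t : ℕ) : MeasurableSet (occSetOf W t) := by
  have hm : Measurable (lastSymbols L : (ℕ → A) → Fin L → A) :=
    measurable_pi_iff.2 fun i => measurable_pi_apply _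
  exact (MeasurableSet.const _).inter (hm W.measurableSet)

/-- Words of equal length exclude each other, so the union has an additive indicator. -/
lemma indicator_occSetOf (W : Finset (Fin L → A)) (t : ℕ) (x : ℕ → A) :
    (occSetOf W t).indicator (1 : (ℕ → A) → ℝ) x =
      ∑ u ∈ W, (occSet (List.ofFn u) t).indicator 1 x := by
  classical
  have h : ∀ u : Fin L → A, x ∈ occSet (List.ofFn u) t ↔ L ≤ t ∧ lastSymbols L x = u := fun u => by
    rw [← mem_wordSet_ofFn, occSet, Set.mem_ofPred_eq, List.length_ofFn]
  simp only [Set.indicator_apply, h, Pi.one_apply]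
  by_cases ht : L ≤ t
  · simp [ht, occSetOf]
  · simp [ht, occSetOf]

lemma stateCount_eq_visits (σ : Set (ℕ → A)) (N : ℕ) (ω : Ω) :
    (stateCount P X κ L N σ ω : ℝ) = visits X (occSetOf (stateWords P X κ L σ)) N ω := by
  rw [stateCount]
  push_cast
  simp only [count_eq_visits, visits, indicator_occSetOf]
  exact Finset.sum_comm

lemma sum_countNext_eq_visitsNext (σ : Set (ℕ → A)) (N : ℕ) (a : A) (ω : Ω) :
    ∑ u ∈ stateWords P X κ L σ, (countNext X N (List.ofFn u) a ω : ℝ) =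
      visitsNext X (occSetOf (stateWords P X κ L σ)) N a ω := by
  simp only [countNext_eq_visitsNext, visitsNext, indicator_occSetOf, Finset.sum_mul]
  exact Finset.sum_comm

/-- For an unseen word the quotient is the default `0`, and the counts of its continuations vanish
too, being nonnegative with sum `0`. -/
lemma count_mul_empMorph (N : ℕ) (w : List A) (a : A) (ω : Ω) :
    (count X N w ω : ℝ) * empMorph X N w ω a = countNext X N w a ω := by
  rcases eq_or_ne (count X N w ω : ℝ) 0 with h | h
  · have h1 : ∀ b, 0 ≤ visitsNext X (occSet w) N b ω := fun b =>
      Finset.sum_nonneg fun _ _ => mul_nonneg (indicator_one_nonneg _ _) (indicator_one_nonneg _ _)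
    have h2 := sum_visitsNext (X := X) (occSet w) N ω
    rw [← count_eq_visits, h] at h2
    rw [countNext_eq_visitsNext, h, zero_mul,
      (Finset.sum_eq_zero_iff_of_nonneg fun b _ => h1 b).1 h2 a (Finset.mem_univ a)]
  · rw [empMorph, mul_div_cancel₀ _ h]

lemma stateEmpMorph_eq (σ : Set (ℕ → A)) (N : ℕ) (ω : Ω) :
    stateEmpMorph P X κ L N σ ω = fun a =>
      visitsNext X (occSetOf (stateWords P X κ L σ)) N a ω /
        visits X (occSetOf (stateWords P X κ L σ)) N ω := by
  funext a
  rw [stateEmpMorph, stateCount_eq_visits, ← sum_countNext_eq_visitsNext]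
  simp only [count_mul_empMorph]

lemma empMorph_eq (N : ℕ) (w : List A) (ω : Ω) :
    empMorph X N w ω = fun a => visitsNext X (occSet w) N a ω / visits X (occSet w) N ω := by
  funext a
  rw [empMorph, count_eq_visits, countNext_eq_visitsNext]

end States

/-- The true morph of a suffix is the morph of the state that it belongs to. -/
lemma IsSuffixIn.wordMorph_eq (hX : ∀ t, Measurable (X t)) (hκ : IsPredictiveKernel P X κ)
    {w : List A} {σ : Set (ℕ → A)} (h : IsSuffixIn P X κ w σ) (hσ : IsCausalState P X κ σ)
    (hlim : ∀ w, Tendsto (avgWordProb P X w) atTop (𝓝 (wordProb P X w)))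
    (hw : wordProb P X w ≠ 0) : wordMorph P X w = stateMorph κ σ := by
  funext a
  rw [wordMorph, div_eq_iff hw]
  have hm : Measurable ((wordSet (w ++ [a])).indicator (1 : (ℕ → A) → ℝ)) :=
    measurable_one.indicator (measurableSet_wordSet _)
  have hneg := negligible_pastSum_sub_nextMean hX hκ hm (K := 1) fun x => by
    rw [abs_of_nonneg (indicator_one_nonneg _ _)]
    exact indicator_one_le_one _ _
  have hae : ∀ᵐ x ∂pastLaw P X, nextMean κ ((wordSet (w ++ [a])).indicator 1) x =
      stateMorph κ σ a * (wordSet w).indicator 1 x := by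
    filter_upwards [h.ae_mem hX hσ] with x hx
    rw [nextMean_indicator_wordSet]
    by_cases hxw : x ∈ wordSet w
    · rw [Set.indicator_of_mem hxw, Set.indicator_of_mem hxw, hσ.stateMorph_eq (hx hxw)]
      rfl
    · rw [Set.indicator_of_notMem hxw, Set.indicator_of_notMem hxw, mul_zero]
  -- After `w` the letter `a` has the constant conditional probability `stateMorph κ σ a`, so the
  -- averages of `w ++ [a]` and of this multiple of `w` differ by a null sequence.
  have h0 := hneg.tendsto_mean
  have h1 := (hlim (w ++ [a])).sub ((hlim w).const_mul (stateMorph κ σ a))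
  have h2 : (fun N : ℕ => (∫ ω, pastSum X ((wordSet (w ++ [a])).indicator 1) N ω -
      pastSum X (nextMean κ ((wordSet (w ++ [a])).indicator 1)) N ω ∂P) / N) =
      fun N => avgWordProb P X (w ++ [a]) N - stateMorph κ σ a * avgWordProb P X w N := by
    funext N
    have e : ∫ ω, pastSum X ((wordSet (w ++ [a])).indicator 1) N ω -
        pastSum X (nextMean κ ((wordSet (w ++ [a])).indicator 1)) N ω ∂P =
        ∫ ω, pastSum X ((wordSet (w ++ [a])).indicator 1) N ω -
          stateMorph κ σ a * pastSum X ((wordSet w).indicator 1) N ω ∂P := by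
      refine integral_congr_ae ?_
      filter_upwards [pastSum_congr_ae hX hae N] with ω hω
      rw [hω]
      simp only [pastSum, Finset.mul_sum]
    rw [e, integral_sub (integrable_pastSum_wordSet hX _ N)
      ((integrable_pastSum_wordSet hX _ N).const_mul _), integral_const_mul, avgWordProb_eq hX,
      avgWordProb_eq hX]
    ring
  rw [h2] at h0
  have := tendsto_nhds_unique h0 h1
  linarith

/-- Deviation of relative frequencies in terms of deviation of counts. -/
lemma measureReal_lt_abs_div_sub_le {Y : ℕ → Ω → ℝ} {p C c : ℝ} (hC : 1 ≤ C)
    (h : ∀ (N : ℕ) (ε : ℝ), 0 ≤ ε →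
      P.real {ω | N * ε < |Y N ω - N * p|} ≤ C * Real.exp (-(c * N * ε ^ 2)))
    (N : ℕ) {ε : ℝ} (hε : 0 ≤ ε) :
    P.real {ω | ε < |Y N ω / N - p|} ≤ C * Real.exp (-N * (c * ε ^ 2)) := by
  -- For `N = 0` the quotient is `0` by convention and need not be near `p`; `1 ≤ C` makes the bound
  -- trivial.
  rcases Nat.eq_zero_or_pos N with rfl | hN
  · refine measureReal_le_one.trans ?_
    simpa using hC
  · have hN' : (0 : ℝ) < N := by exact_mod_cast hN
    refine le_trans (le_of_eq ?_) ((h N ε hε).trans (le_of_eq ?_))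
    · congr 1
      ext ω
      have : Y N ω - N * p = N * (Y N ω / N - p) := by field_simp
      rw [Set.mem_ofPred_eq, Set.mem_ofPred_eq, this, abs_mul, abs_of_pos hN',
        mul_lt_mul_iff_right₀ hN']
    · congr 2
      ring

/-- A ratio of two counts is close to the ratio of their rates if the counts are close to
theirs. -/
lemma abs_div_sub_div_le {n m p p' N δ : ℝ} (hN : 0 < N) (hp : 0 < p) (hp1 : p ≤ 1)
    (hp' : 0 ≤ p') (hp'1 : p' ≤ 1) (hδ : δ ≤ p / 2) (hn : |n - N * p| ≤ N * δ)
    (hm : |m - N * p'| ≤ N * δ) : 0 < n ∧ |m / n - p' / p| ≤ 4 * δ / p ^ 2 := by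
  have hn1 : N * (p / 2) ≤ n := by
    have := (abs_le.1 hn).1
    nlinarith
  have hNp : 0 < N * (p / 2) := by positivity
  have hn0 : 0 < n := hNp.trans_le hn1
  refine ⟨hn0, ?_⟩
  have hδ0 : 0 ≤ N * δ := (abs_nonneg _).trans hn
  have e : m / n - p' / p = ((m - N * p') * p - p' * (n - N * p)) / (n * p) := by
    field_simp
    ring
  rw [e, abs_div, abs_of_pos (mul_pos hn0 hp)]
  have hnum : |(m - N * p') * p - p' * (n - N * p)| ≤ 2 * (N * δ) := by
    refine (abs_sub _ _).trans ?_
    rw [abs_mul, abs_mul, abs_of_pos hp, abs_of_nonneg hp']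
    have h1 := mul_le_mul hm hp1 hp.le hδ0
    have h2 := mul_le_mul hp'1 hn (abs_nonneg _) zero_le_one
    linarith
  calc _ ≤ 2 * (N * δ) / (n * p) := by gcongr
    _ ≤ 2 * (N * δ) / (N * (p / 2) * p) := by gcongr
    _ = _ := by field_simp; ring

end Words

/-! ### Error probabilities and union bounds -/

section Bounds

variable {A Ω : Type*} [Fintype A] [MeasurableSpace A] [MeasurableSingletonClass A]
  [MeasurableSpace Ω]
variable {P : Measure Ω} [IsProbabilityMeasure P] {X : ℤ → Ω → A} {κ : Kernel (ℕ → A) (ℕ → A)}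
  [IsMarkovKernel κ]

lemma measureReal_wordFails_le (hX : ∀ t, Measurable (X t)) (hκ : IsPredictiveKernel P X κ)
    {w : List A} {σ : Set (ℕ → A)} (h : IsSuffixIn P X κ w σ) (hσ : IsCausalState P X κ σ)
    (hlim : ∀ w, Tendsto (avgWordProb P X w) atTop (𝓝 (wordProb P X w)))
    {N : ℕ} {p₀ ε D s : ℝ} (hs : 0 < s) (hp₀ : 0 < p₀) (hp : p₀ ≤ wordProb P X w)
    (hD : P.real {ω | ε < |(count X N w ω : ℝ) / N - wordProb P X w|} ≤ D) :
    P.real {ω | WordFails P X N s w ω} ≤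
      2 ^ (Fintype.card A + 1) * Real.exp (-N * (p₀ - ε) * s ^ 2 / 2) + D := by
  simp only [count_eq_visits] at hD
  have hq : ∀ t, ∀ᵐ x ∂pastLaw P X, x ∈ occSet w t →
      ∀ a, (nextLaw κ x).real {a} = stateMorph κ σ a := fun t => by
    filter_upwards [h.ae_mem hX hσ] with x hx hmem a using hσ.stateMorph_eq (hx hmem.2) a
  have := measureReal_fails_le hX hκ (measurableSet_occSet w) hσ.sum_stateMorph hq N hs hp hD
  refine le_trans (le_of_eq ?_) this
  congr 1
  ext ω
  rw [Set.mem_ofPred_eq, Set.mem_ofPred_eq, WordFails, ← count_eq_visits, Nat.cast_eq_zero,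
    empMorph_eq, h.wordMorph_eq hX hκ hσ hlim (hp₀.trans_le hp).ne', count_eq_visits]

/-- All histories of length `L` in the state share its morph, so they are treated as one set of
pasts; no union bound over words is paid. -/
lemma measureReal_stateFails_le (hX : ∀ t, Measurable (X t)) (hκ : IsPredictiveKernel P X κ)
    {L : ℕ} {σ : Set (ℕ → A)} (hσ : IsCausalState P X κ σ)
    {N : ℕ} {p₀ ε D s : ℝ} (hs : 0 < s) (hp : p₀ ≤ stateProb P X κ L σ)
    (hD : P.real {ω | ε < |(stateCount P X κ L N σ ω : ℝ) / N - stateProb P X κ L σ|} ≤ D) :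
    P.real {ω | StateFails P X κ L N s σ ω} ≤
      2 ^ (Fintype.card A + 1) * Real.exp (-N * (p₀ - ε) * s ^ 2 / 2) + D := by
  simp only [stateCount_eq_visits] at hD
  have hq : ∀ t, ∀ᵐ x ∂pastLaw P X, x ∈ occSetOf (stateWords P X κ L σ) t →
      ∀ a, (nextLaw κ x).real {a} = stateMorph κ σ a := fun t => by
    have hall : ∀ᵐ x ∂pastLaw P X, ∀ u ∈ stateWords P X κ L σ,
        x ∈ wordSet (List.ofFn u) → causalState κ x = σ :=
      (ae_ball_iff (Finset.countable_toSet _)).2 fun u hu =>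
        IsSuffixIn.ae_mem hX (mem_stateWords.1 hu) hσ
    filter_upwards [hall] with x hx hmem a
    exact hσ.stateMorph_eq (hx _ hmem.2 (mem_wordSet_ofFn.2 rfl)) a
  have := measureReal_fails_le hX hκ (measurableSet_occSetOf _) hσ.sum_stateMorph hq N hs hp hD
  refine le_trans (le_of_eq ?_) this
  congr 1
  ext ω
  rw [Set.mem_ofPred_eq, Set.mem_ofPred_eq, StateFails, stateEmpMorph_eq, ← stateCount_eq_visits,
    Nat.cast_eq_zero]

/-- Exponential decay for all possible words: both the counts and the counts of the
continuations concentrate around their rates. -/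
lemma exists_bound_possible {L : ℕ} {p₀ C c : ℝ} (hp₀ : 0 < p₀) (hC : 0 ≤ C) (hc : 0 < c)
    (hp : ∀ w : List A, w.length ≤ L → IsPossible P X w → p₀ ≤ wordProb P X w)
    (h01 : ∀ w : List A, 0 ≤ wordProb P X w ∧ wordProb P X w ≤ 1)
    (h1 : ∀ w : List A, w.length ≤ L → ∀ (N : ℕ) (ε : ℝ), 0 ≤ ε →
      P.real {ω | N * ε < |(count X N w ω : ℝ) - N * wordProb P X w|} ≤
        C * Real.exp (-(c * N * ε ^ 2)))
    (h2 : ∀ w : List A, w.length ≤ L → ∀ (a : A) (N : ℕ) (ε : ℝ), 0 ≤ ε →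
      P.real {ω | N * ε < |(countNext X N w a ω : ℝ) - N * wordProb P X (w ++ [a])|} ≤
        C * Real.exp (-(c * N * ε ^ 2))) :
    ∃ B : ℝ, 0 ≤ B ∧ ∀ t : ℝ, 0 < t → ∃ c' : ℝ, 0 < c' ∧ ∀ N : ℕ,
      P.real {ω | ∃ w : List A, w.length ≤ L ∧ IsPossible P X w ∧ WordFails P X N t w ω} ≤
        B * Real.exp (-c' * N) := by
  classical
  set W : Finset (List A) := (List.finite_length_le A L).toFinset with hW
  have hmemW : ∀ w : List A, w ∈ W ↔ w.length ≤ L := fun w => by simp [hW]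
  obtain ⟨k, hk⟩ : ∃ k : ℝ, k = Fintype.card A := ⟨_, rfl⟩
  have hk0 : 0 ≤ k := hk ▸ Nat.cast_nonneg _
  have hB0 : 0 ≤ W.card * (C + k * C) := by positivity
  -- The summand `1` covers `N = 0`, where every word is unseen.
  refine ⟨W.card * (C + k * C) + 1, by positivity, fun t ht => ?_⟩
  -- The first bound keeps the count positive; the second makes `k` letter errors of size `4 * δ /
  -- p₀ ^ 2` add up to less than `t`.
  set δ : ℝ := min (p₀ / 2) (t * p₀ ^ 2 / (8 * (k + 1))) with hδ
  have hδ0 : 0 < δ := lt_min (by positivity) (by positivity)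
  refine ⟨c * δ ^ 2, by positivity, fun N => ?_⟩
  have hexp := Real.exp_pos (-(c * δ ^ 2) * N)
  rcases Nat.eq_zero_or_pos N with rfl | hN
  · refine measureReal_le_one.trans ?_
    simpa using hB0
  have hN' : (0 : ℝ) < N := by exact_mod_cast hN
  have hsub : {ω | ∃ w : List A, w.length ≤ L ∧ IsPossible P X w ∧ WordFails P X N t w ω} ⊆
      ⋃ w ∈ W, ({ω | N * δ < |(count X N w ω : ℝ) - N * wordProb P X w|} ∪
        ⋃ a ∈ (Finset.univ : Finset A),
          {ω | N * δ < |(countNext X N w a ω : ℝ) - N * wordProb P X (w ++ [a])|}) := by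
    rintro ω ⟨w, hwL, hwp, hf⟩
    simp only [Set.mem_iUnion, Set.mem_union, Set.mem_ofPred_eq]
    refine ⟨w, (hmemW w).2 hwL, ?_⟩
    by_contra! hcon
    obtain ⟨hcon1, hcon2⟩ := hcon
    have hpw := hp w hwL hwp
    have hpw0 := hp₀.trans_le hpw
    have hδp : δ ≤ wordProb P X w / 2 := (min_le_left _ _).trans (by linarith)
    have key := fun a => abs_div_sub_div_le hN' hpw0 (h01 w).2 (h01 (w ++ [a])).1
      (h01 (w ++ [a])).2 hδp hcon1 (hcon2 a (Finset.mem_univ a))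
    rcases hf with h0 | hf
    -- Positivity of the count comes from `key`, which needs some letter; a sample point supplies
    -- one.
    · obtain ⟨t', ht'⟩ := hwp
      obtain ⟨ω', -⟩ := nonempty_of_measure_ne_zero ht'
      have := (key (X 0 ω')).1
      simp [h0] at this
    · have hle : varDist (empMorph X N w ω) (wordMorph P X w) ≤ k * (4 * δ / p₀ ^ 2) := by
        refine (Finset.sum_le_card_nsmul _ _ (4 * δ / p₀ ^ 2) fun a _ => ?_).trans
          (le_of_eq (by rw [nsmul_eq_mul, Finset.card_univ, hk]))
        exact (key a).2.trans (by gcongr)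
      have hδt : δ * (8 * (k + 1)) ≤ t * p₀ ^ 2 :=
        (le_div_iff₀ (by positivity)).1 (min_le_right _ _)
      have hlt : k * (4 * δ / p₀ ^ 2) < t := by
        rw [← mul_div_assoc, div_lt_iff₀ (by positivity)]
        nlinarith [mul_nonneg hk0 hδ0.le]
      linarith
  have hnum : ∀ w ∈ W, P.real ({ω | N * δ < |(count X N w ω : ℝ) - N * wordProb P X w|} ∪
        ⋃ a ∈ (Finset.univ : Finset A),
          {ω | N * δ < |(countNext X N w a ω : ℝ) - N * wordProb P X (w ++ [a])|}) ≤
      (C + k * C) * Real.exp (-(c * δ ^ 2) * N) := by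
    intro w hw
    have hwL := (hmemW w).1 hw
    have e : -(c * N * δ ^ 2) = -(c * δ ^ 2) * N := by ring
    refine (measureReal_union_le _ _).trans ?_
    rw [add_mul, mul_assoc k]
    refine add_le_add (by rw [← e]; exact h1 w hwL N δ hδ0.le) ?_
    refine (measureReal_biUnion_finset_le _ _).trans ?_
    refine (Finset.sum_le_card_nsmul _ _ _ fun a _ => h2 w hwL a N δ hδ0.le).trans ?_
    rw [nsmul_eq_mul, Finset.card_univ, e, hk]
  calc _ ≤ _ := measureReal_mono hsub (measure_ne_top _ _)
    _ ≤ _ := measureReal_biUnion_finset_le _ _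
    _ ≤ W.card • ((C + k * C) * Real.exp (-(c * δ ^ 2) * N)) :=
        Finset.sum_le_card_nsmul _ _ _ hnum
    _ ≤ _ := by
        rw [nsmul_eq_mul, ← mul_assoc]
        exact mul_le_mul_of_nonneg_right (by linarith) hexp.le

lemma measureReal_exists_suffix_le {L : ℕ} {D : ℝ} (hD : 0 ≤ D) {S : List A → Prop}
    {E : List A → Set Ω} (h : ∀ w : List A, w.length ≤ L → S w → P.real (E w) ≤ D) :
    P.real {ω | ∃ w : List A, w.length ≤ L ∧ S w ∧ ω ∈ E w} ≤
      (∑ l ∈ Finset.range (L + 1), (Fintype.card A : ℝ) ^ l) * D := by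
  classical
  have hsub : {ω | ∃ w : List A, w.length ≤ L ∧ S w ∧ ω ∈ E w} ⊆
      ⋃ l ∈ Finset.range (L + 1), ⋃ u ∈ (Finset.univ : Finset (Fin l → A)),
        {ω | S (List.ofFn u) ∧ ω ∈ E (List.ofFn u)} := by
    rintro ω ⟨w, hwL, hS, hw⟩
    simp only [Set.mem_iUnion, Set.mem_ofPred_eq]
    exact ⟨w.length, Finset.mem_range.2 (Nat.lt_succ_of_le hwL), w.get, Finset.mem_univ _,
      by rw [List.ofFn_get]; exact ⟨hS, hw⟩⟩
  calc _ ≤ _ := measureReal_mono hsub (measure_ne_top _ _)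
    _ ≤ _ := measureReal_biUnion_finset_le _ _
    _ ≤ ∑ l ∈ Finset.range (L + 1), (Fintype.card A : ℝ) ^ l * D := by
        refine Finset.sum_le_sum fun l hl => ?_
        refine (measureReal_biUnion_finset_le _ _).trans
          ((Finset.sum_le_card_nsmul _ _ D fun u _ => ?_).trans (le_of_eq ?_))
        · by_cases hS : S (List.ofFn u)
          · simp only [hS, true_and]
            exact h _ (by rw [List.length_ofFn]; exact Nat.lt_succ_iff.1 (Finset.mem_range.1 hl)) hS
          · simpa [hS] using hD
        · rw [nsmul_eq_mul, Finset.card_univ, Fintype.card_fun, Fintype.card_fin]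
          push_cast
          rfl
    _ = _ := by rw [Finset.sum_mul]

lemma measureReal_exists_state_le [Fintype (State P X κ)] {D : ℝ} {E : Set (ℕ → A) → Set Ω}
    (h : ∀ σ, IsCausalState P X κ σ → P.real (E σ) ≤ D) :
    P.real {ω | ∃ σ, IsCausalState P X κ σ ∧ ω ∈ E σ} ≤
      (Set.ncard {σ | IsCausalState P X κ σ} : ℝ) * D := by
  have hsub : {ω | ∃ σ, IsCausalState P X κ σ ∧ ω ∈ E σ} ⊆
      ⋃ σ ∈ (Finset.univ : Finset (State P X κ)), E σ.1 := by
    rintro ω ⟨σ, hσ, hω⟩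
    simp only [Set.mem_iUnion]
    exact ⟨⟨σ, hσ⟩, Finset.mem_univ _, hω⟩
  have hcard : Set.ncard {σ | IsCausalState P X κ σ} = (Finset.univ : Finset (State P X κ)).card := by
    rw [Finset.card_univ, ← Nat.card_eq_fintype_card]
    rfl
  rw [hcard, ← nsmul_eq_mul]
  exact (measureReal_mono hsub (measure_ne_top _ _)).trans
    ((measureReal_biUnion_finset_le _ _).trans
      (Finset.sum_le_card_nsmul _ _ _ fun σ _ => h σ.1 σ.2))

lemma sInf_image_pos {E : Type*} {s : Set E} (hs : s.Finite) (hne : s.Nonempty) {f : E → ℝ}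
    (hf : ∀ x ∈ s, 0 < f x) : 0 < sInf (f '' s) := by
  obtain ⟨x, hx, he⟩ := (hne.image f).csInf_mem (hs.image f)
  rw [← he]
  exact hf x hx

lemma sInf_image_le {E : Type*} {s : Set E} (hs : s.Finite) {f : E → ℝ} {x : E} (hx : x ∈ s) :
    sInf (f '' s) ≤ f x :=
  csInf_le (hs.image f).bddBelow (Set.mem_image_of_mem f hx)

end Bounds

end

end CausalStates

/-! ### Choice of common constants and conclusion -/

theorem mainTheorem2 {A Ω : Type*} [Fintype A] [MeasurableSpace A] [MeasurableSingletonClass A]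
    [MeasurableSpace Ω] (P : Measure Ω) [IsProbabilityMeasure P]
    (X : ℤ → Ω → A) (hX : ∀ t, Measurable (X t))
    (κ : Kernel (ℕ → A) (ℕ → A)) [IsMarkovKernel κ]
    (hκ : CausalStates.IsPredictiveKernel P X κ)
    (hfin : CausalStates.FinitelyManyCausalStates P X κ)
    (hirr : CausalStates.CausalStatesIrreducible P X κ)
    (L : ℕ)
    (hL : ∀ σ, CausalStates.IsCausalState P X κ σ →
      ∃ w : List A, w.length ≤ L ∧ CausalStates.IsSuffixIn P X κ w σ) :
    -- the word probabilities exist, and the smallest relevant ones are positive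
    (∀ w : List A, Tendsto (CausalStates.avgWordProb P X w) atTop
      (𝓝 (CausalStates.wordProb P X w))) ∧
    0 < CausalStates.pStar P X L ∧
    0 < CausalStates.pStarState P X κ L ∧
    ∃ (C : ℝ) (r : ℝ → ℝ), StrictMonoOn r (Set.Ici 0) ∧ r 0 = 0 ∧
      -- large-deviation bound for the counts of the suffixes
      (∀ w : List A, w.length ≤ L → ∀ (N : ℕ) (ε : ℝ), 0 ≤ ε →
        P.real {ω | ε < |(CausalStates.count X N w ω : ℝ) / N - CausalStates.wordProb P X w|}
          ≤ C * Real.exp (-N * r ε)) ∧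
      -- large-deviation bound for the counts of the causal states
      (∀ σ, CausalStates.IsCausalState P X κ σ → ∀ (N : ℕ) (ε : ℝ), 0 ≤ ε →
        P.real {ω | ε < |(CausalStates.stateCount P X κ L N σ ω : ℝ) / N
            - CausalStates.stateProb P X κ L σ|}
          ≤ C * Real.exp (-N * r ε)) ∧
      -- error bound for the morphs of the suffixes in the causal states
      (∀ (N : ℕ) (t ε : ℝ), 0 < t → 0 ≤ ε →
        P.real {ω | ∃ w : List A, w.length ≤ L ∧
            (∃ σ, CausalStates.IsCausalState P X κ σ ∧ CausalStates.IsSuffixIn P X κ w σ) ∧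
            CausalStates.WordFails P X N t w ω}
          ≤ (∑ l ∈ Finset.range (L + 1), (Fintype.card A : ℝ) ^ l) *
            (2 ^ (Fintype.card A + 1) *
                Real.exp (-N * (CausalStates.pStar P X L - ε) * t ^ 2 / 2)
              + C * Real.exp (-N * r ε))) ∧
      -- error bound for the morphs of the causal states
      (∀ (N : ℕ) (t ε : ℝ), 0 < t → 0 ≤ ε →
        P.real {ω | ∃ σ, CausalStates.IsCausalState P X κ σ ∧
            CausalStates.StateFails P X κ L N t σ ω}
          ≤ (Set.ncard {σ | CausalStates.IsCausalState P X κ σ} : ℝ) *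
            (2 ^ (Fintype.card A + 1) *
                Real.exp (-N * (CausalStates.pStarState P X κ L - ε) * t ^ 2 / 2)
              + C * Real.exp (-N * r ε))) ∧
      -- exponential decay, for all possible suffixes and for all causal states
      (∃ B : ℝ, ∀ t : ℝ, 0 < t → ∃ c : ℝ, 0 < c ∧ ∀ N : ℕ,
        P.real {ω | ∃ w : List A, w.length ≤ L ∧ CausalStates.IsPossible P X w ∧
            CausalStates.WordFails P X N t w ω} ≤ B * Real.exp (-c * N) ∧
        P.real {ω | ∃ σ, CausalStates.IsCausalState P X κ σ ∧
            CausalStates.StateFails P X κ L N t σ ω} ≤ B * Real.exp (-c * N)) := by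
  have : Finite (CausalStates.State P X κ) := (CausalStates.finite_causalStates hfin).to_subtype
  have := Fintype.ofFinite (CausalStates.State P X κ)
  choose p hneg hposs using CausalStates.exists_wordRate (κ := κ) hX hκ hfin hirr
  have hlim := fun w => (CausalStates.wordProb_of_negligible hX (hneg w)).1
  have hpe := fun w => (CausalStates.wordProb_of_negligible hX (hneg w)).2
  have hcount := fun w => CausalStates.negligible_count_of_negligible hX (hneg w)
  have hnext := fun w a => CausalStates.negligible_countNext_of_negligible hX (hcount (w ++ [a]))
  simp only [← hpe] at hposs hcount hnext
  have hstate : ∀ σ, CausalStates.Negligible P (fun N ω =>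
      (CausalStates.stateCount P X κ L N σ ω : ℝ) - N * CausalStates.stateProb P X κ L σ) := by
    intro σ
    refine (CausalStates.Negligible.sum (CausalStates.stateWords P X κ L σ)
      fun u _ => hcount (List.ofFn u)).congr_ae fun N => Eventually.of_forall fun ω => ?_
    simp only [CausalStates.stateCount, CausalStates.stateProb, Finset.sum_sub_distrib,
      Finset.mul_sum]
    push_cast
    rfl
  have hwfin : {w : List A | w.length ≤ L ∧ CausalStates.IsPossible P X w}.Finite :=
    (List.finite_length_le A L).subset fun w hw => hw.1
  have hsfin := CausalStates.finite_causalStates hfin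
  have hpStar : 0 < CausalStates.pStar P X L := by
    -- The empty word is possible, so the infimum is over a nonempty finite set and is attained.
    refine CausalStates.sInf_image_pos hwfin ⟨[], Nat.zero_le _, 0, ?_⟩ fun w hw => hposs w hw.2
    simp [CausalStates.endsWith_eq]
  have hpStarState : 0 < CausalStates.pStarState P X κ L := by
    obtain ⟨σ, hσ⟩ := CausalStates.nonempty_state (κ := κ) hX hκ hfin
    refine CausalStates.sInf_image_pos hsfin ⟨σ, hσ⟩ fun τ hτ => ?_
    obtain ⟨w, hwL, hw⟩ := hL τ hτ
    obtain ⟨u, hu⟩ := hw.exists_stateWord hwL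
    exact Finset.sum_pos (fun v hv => hposs _ (CausalStates.mem_stateWords.1 hv).1) ⟨u, hu⟩
  have hpStar_le : ∀ w : List A, w.length ≤ L → CausalStates.IsPossible P X w →
      CausalStates.pStar P X L ≤ CausalStates.wordProb P X w := fun w hw hw' =>
    CausalStates.sInf_image_le hwfin ⟨hw, hw'⟩
  have hpStarState_le : ∀ σ, CausalStates.IsCausalState P X κ σ →
      CausalStates.pStarState P X κ L ≤ CausalStates.stateProb P X κ L σ := fun σ hσ =>
    CausalStates.sInf_image_le hsfin hσ
  obtain ⟨C₁, c₁, hC₁, hc₁, ht₁⟩ := CausalStates.Negligible.uniform_tail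
    (List.finite_length_le A L).toFinset fun w _ => hcount w
  obtain ⟨C₂, c₂, hC₂, hc₂, ht₂⟩ := CausalStates.Negligible.uniform_tail
    hsfin.toFinset fun σ _ => hstate σ
  obtain ⟨C₃, c₃, hC₃, hc₃, ht₃⟩ := CausalStates.Negligible.uniform_tail
    ((List.finite_length_le A L).toFinset ×ˢ (Finset.univ : Finset A)) fun q _ => hnext q.1 q.2
  -- Common constants for words, states and continuations; the `1` makes the bounds trivial at `N =
  -- 0`.
  set C : ℝ := C₁ + C₂ + C₃ + 1 with hC
  set c : ℝ := min c₁ (min c₂ c₃) with hc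
  have hc0 : 0 < c := lt_min hc₁ (lt_min hc₂ hc₃)
  have hmono : ∀ {C' c' : ℝ}, 0 ≤ C' → C' ≤ C → c ≤ c' → ∀ (N : ℕ) (ε : ℝ),
      C' * Real.exp (-(c' * N * ε ^ 2)) ≤ C * Real.exp (-(c * N * ε ^ 2)) := by
    intro C' c' h0 h1 h2 N ε
    gcongr
  have htW : ∀ w : List A, w.length ≤ L → ∀ (N : ℕ) (ε : ℝ), 0 ≤ ε →
      P.real {ω | N * ε < |(CausalStates.count X N w ω : ℝ) - N * CausalStates.wordProb P X w|} ≤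
        C * Real.exp (-(c * N * ε ^ 2)) := fun w hw N ε hε =>
    (ht₁ w (by simpa using hw) N ε hε).trans
      (hmono hC₁ (by linarith) (min_le_left _ _) N ε)
  have htS : ∀ σ, CausalStates.IsCausalState P X κ σ → ∀ (N : ℕ) (ε : ℝ), 0 ≤ ε →
      P.real {ω | N * ε < |(CausalStates.stateCount P X κ L N σ ω : ℝ) -
        N * CausalStates.stateProb P X κ L σ|} ≤ C * Real.exp (-(c * N * ε ^ 2)) :=
    fun σ hσ N ε hε => (ht₂ σ (by simpa using hσ) N ε hε).trans
      (hmono hC₂ (by linarith) ((min_le_right _ _).trans (min_le_left _ _)) N ε)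
  have htN : ∀ w : List A, w.length ≤ L → ∀ (a : A) (N : ℕ) (ε : ℝ), 0 ≤ ε →
      P.real {ω | N * ε < |(CausalStates.countNext X N w a ω : ℝ) -
        N * CausalStates.wordProb P X (w ++ [a])|} ≤ C * Real.exp (-(c * N * ε ^ 2)) :=
    fun w hw a N ε hε => (ht₃ (w, a) (by simpa using hw) N ε hε).trans
      (hmono hC₃ (by linarith) ((min_le_right _ _).trans (min_le_right _ _)) N ε)
  have hC1 : 1 ≤ C := by linarith
  have hdevW := fun w hw => CausalStates.measureReal_lt_abs_div_sub_le hC1 (htW w hw)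
  have hdevS := fun σ hσ => CausalStates.measureReal_lt_abs_div_sub_le hC1 (htS σ hσ)
  have hstates : ∀ (N : ℕ) (t ε : ℝ), 0 < t → 0 ≤ ε →
      P.real {ω | ∃ σ, CausalStates.IsCausalState P X κ σ ∧
          CausalStates.StateFails P X κ L N t σ ω}
        ≤ (Set.ncard {σ | CausalStates.IsCausalState P X κ σ} : ℝ) *
          (2 ^ (Fintype.card A + 1) *
              Real.exp (-N * (CausalStates.pStarState P X κ L - ε) * t ^ 2 / 2)
            + C * Real.exp (-N * (c * ε ^ 2))) := fun N t ε ht hε =>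
    CausalStates.measureReal_exists_state_le
      (E := fun σ => {ω | CausalStates.StateFails P X κ L N t σ ω}) fun σ hσ =>
      CausalStates.measureReal_stateFails_le hX hκ hσ ht (hpStarState_le σ hσ) (hdevS σ hσ N hε)
  refine ⟨hlim, hpStar, hpStarState, C, fun ε => c * ε ^ 2, ?_, by simp,
    fun w hw N ε hε => hdevW w hw N hε, fun σ hσ N ε hε => hdevS σ hσ N hε, ?_, hstates, ?_⟩
  · intro x hx y _ hxy
    exact mul_lt_mul_of_pos_left (pow_lt_pow_left₀ hxy hx two_ne_zero) hc0
  · intro N t ε ht hε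
    refine CausalStates.measureReal_exists_suffix_le (by positivity)
      (S := fun w => ∃ σ, CausalStates.IsCausalState P X κ σ ∧ CausalStates.IsSuffixIn P X κ w σ)
      (E := fun w => {ω | CausalStates.WordFails P X N t w ω}) ?_
    rintro w hw ⟨σ, hσ, hsuf⟩
    exact CausalStates.measureReal_wordFails_le hX hκ hsuf hσ hlim ht hpStar
      (hpStar_le w hw hsuf.1) (hdevW w hw N hε)
  · obtain ⟨B, hB, hdecay⟩ := CausalStates.exists_bound_possible hpStar (by linarith) hc0 hpStar_le
      (fun w => CausalStates.wordProb_mem_Icc (hlim w)) htW htN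
    set B' : ℝ := (Set.ncard {σ | CausalStates.IsCausalState P X κ σ} : ℝ) *
      (2 ^ (Fintype.card A + 1) + C) with hB'
    have hB'0 : 0 ≤ B' := by positivity
    refine ⟨B + B', fun t ht => ?_⟩
    obtain ⟨c', hc', hdecay⟩ := hdecay t ht
    set ps := CausalStates.pStarState P X κ L
    -- These are the two exponents of the bound for states at `ε = ps / 2`.
    set c'' : ℝ := min (ps * t ^ 2 / 4) (c * (ps / 2) ^ 2) with hc''
    have hc''0 : 0 < c'' := lt_min (by positivity) (by positivity)
    refine ⟨min c' c'', lt_min hc' hc''0, fun N => ⟨?_, ?_⟩⟩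
    · refine (hdecay N).trans ?_
      gcongr
      · linarith
      · exact min_le_left _ _
    · refine (hstates N t (ps / 2) ht (by positivity)).trans ?_
      have hN : (0 : ℝ) ≤ N := Nat.cast_nonneg N
      have e1 : Real.exp (-N * (ps - ps / 2) * t ^ 2 / 2) ≤ Real.exp (-min c' c'' * N) := by
        refine Real.exp_le_exp.2 ?_
        have := mul_le_mul_of_nonneg_right
          ((min_le_right c' c'').trans (min_le_left (ps * t ^ 2 / 4) _)) hN
        linarith
      have e2 : Real.exp (-N * (c * (ps / 2) ^ 2)) ≤ Real.exp (-min c' c'' * N) := by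
        refine Real.exp_le_exp.2 ?_
        have := mul_le_mul_of_nonneg_right
          ((min_le_right c' c'').trans (min_le_right _ (c * (ps / 2) ^ 2))) hN
        linarith
      calc _ ≤ (Set.ncard {σ | CausalStates.IsCausalState P X κ σ} : ℝ) *
            (2 ^ (Fintype.card A + 1) * Real.exp (-min c' c'' * N) +
              C * Real.exp (-min c' c'' * N)) := by gcongr
        _ = B' * Real.exp (-min c' c'' * N) := by rw [hB']; ring
        _ ≤ _ := by gcongr; linarith
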